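/- Let $R$ be a commutative ring and $C$ a semidualizing $R$-module, that is: $C$ has a (possibly unbounded) resolution by free $R$-modules of finite rank, the homothety map $R\to\operatorname{Hom}_R(C,C)$ is an isomorphism, and $\operatorname{Ext}^{i}_R(C,C)=0$ for all $i\ge 1$. All classes below are classes of $R$-modules closed under isomorphism, and complexes $X=(\cdots\to X_1\xrightarrow{\partial_1}X_0\xrightarrow{\partial_0}X_{-1}\to\cdots)$ are indexed by $\mathbb Z$. - For a class $\mathcal X$ of $R$-modules, $\mathcal G(\mathcal X)$ is the class of modules $M\cong\operatorname{Coker}(\partial_1^X)$, where $X$ is an exact complex of modules in $\mathcal X$ such that the complexes $\operatorname{Hom}_R(X',X)$ and $\operatorname{Hom}_R(X,X')$ are exact for all $X'\in\mathcal X$. - $\mathcal P_C(R)$ is the class of modules $P\otimes_R C$ with $P$ projective, $\mathcal P_C^f(R)$ is the class of finitely generated modules in $\mathcal P_C(R)$, and $\mathcal I_C(R)$ is the class of modules $\operatorname{Hom}_R(C,I)$ with $I$ injective. - $\mathcal{GP}_C(R)$ is the class of modules $M\cong\operatorname{Coker}(\partial_1^X)$, where $X$ is an exact complex with $X_i$ projective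 for $i\ge 0$ and $X_i\in\mathcal P_C(R)$ for $i<0$, such that $\operatorname{Hom}_R(X,Q)$ is exact for all $Q\in\mathcal P_C(R)$. - $\mathcal{GI}_C(R)$ is the class of modules $N\cong\operatorname{Ker}(\partial_0^Y)$, where $Y$ is an exact complex with $Y_i$ injective for $i\le 0$ and $Y_i\in\mathcal I_C(R)$ for $i>0$, such that $\operatorname{Hom}_R(J,Y)$ is exact for all $J\in\mathcal I_C(R)$. - The Auslander class $\mathcal A_C(R)$ is the class of modules $M$ with $\operatorname{Tor}^R_{i}(C,M)=0=\operatorname{Ext}_R^{i}(C,C\otimes_R M)$ for all $i\ge 1$ such that the natural map $M\to\operatorname{Hom}_R(C,C\otimes_R M)$ is an isomorphism. - The Bass class $\mathcal B_C(R)$ is the class of modules $N$ with $\operatorname{Ext}_R^{i}(C,N)=0=\operatorname{Tor}^R_{i}(C,\operatorname{Hom}_R(C,N))$ for all $i\ge 1$ such that the evaluation map $C\otimes_R\operatorname{Hom}_R(C,N)\to N$ is an isomorphism. - If $R$ is noetherian, $\mathcal G_C(R)$ is the class of totally $C$-reflexive modules: finitely generated modules $H$ with $\operatorname{Ext}_R^{i}(H,C)=0=\operatorname{Ext}_R^{i}(\operatorname{Hom}_R(H,C),C)$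 for all $i\ge 1$ such that the biduality map $H\to\operatorname{Hom}_R(\operatorname{Hom}_R(H,C),C)$ is an isomorphism. Then $$\mathcal G(\mathcal P_C(R))=\mathcal{GP}_C(R)\cap\mathcal B_C(R)\quad\text{and}\quad \mathcal G(\mathcal I_C(R))=\mathcal{GI}_C(R)\cap\mathcal A_C(R).$$ If moreover $R$ is noetherian, then $$\mathcal G(\mathcal P_C^f(R))=\mathcal G_C(R)\cap\mathcal B_C(R).$$ -/

import Mathlib

open CategoryTheory CategoryTheory.Limits
open scoped TensorProduct

universe u

noncomputable section

namespace GorensteinCat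

variable {R : Type u} [CommRing R]

/-- The complex `Hom(A, X)` of abelian groups is exact (kernel equals image at every spot). -/
def HomFromExact (A : ModuleCat.{u} R) (X : ChainComplex (ModuleCat.{u} R) ℤ) : Prop :=
  ∀ n : ℤ, Function.Exact (fun f : A ⟶ X.X (n + 1) => f ≫ X.d (n + 1) n)
    (fun f : A ⟶ X.X n => f ≫ X.d n (n - 1))

/-- The complex `Hom(X, B)` of abelian groups is exact (kernel equals image at every spot). -/
def HomToExact (X : ChainComplex (ModuleCat.{u} R) ℤ) (B : ModuleCat.{u} R) : Prop :=
  ∀ n : ℤ, Function.Exact (fun f : X.X (n - 1) ⟶ B => X.d n (n - 1) ≫ f)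
    (fun f : X.X n ⟶ B => X.d (n + 1) n ≫ f)

/-- `X` is a totally `𝒳`-acyclic complex: an exact complex of objects of `𝒳` which is both
`Hom(𝒳, -)`-exact and `Hom(-, 𝒳)`-exact. -/
structure IsTotallyAcyclic (𝒳 : ObjectProperty (ModuleCat.{u} R))
    (X : ChainComplex (ModuleCat.{u} R) ℤ) : Prop where
  mem : ∀ n : ℤ, 𝒳 (X.X n)
  exact : X.Acyclic
  homFrom_exact : ∀ A : ModuleCat.{u} R, 𝒳 A → HomFromExact A X
  homTo_exact : ∀ B : ModuleCat.{u} R, 𝒳 B → HomToExact X B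

/-- The Gorenstein subcategory `𝒢(𝒳)`: modules isomorphic to `Coker (X₁ ⟶ X₀)` for some totally
`𝒳`-acyclic complex `X`. -/
def gorenstein (𝒳 : ObjectProperty (ModuleCat.{u} R)) : ObjectProperty (ModuleCat.{u} R) :=
  fun M => ∃ X : ChainComplex (ModuleCat.{u} R) ℤ,
    IsTotallyAcyclic 𝒳 X ∧ Nonempty (M ≅ cokernel (X.d 1 0))

/-- `Ext^{≥ 1}_R(M, N) = 0`. -/
def ExtVanish (M N : ModuleCat.{u} R) : Prop :=
  ∀ n : ℕ, 1 ≤ n → Subsingleton (Abelian.Ext.{u} M N n)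

/-- `Tor_{≥ 1}^R(M, N) = 0`. -/
def TorVanish (M N : ModuleCat.{u} R) : Prop :=
  ∀ n : ℕ, 1 ≤ n → IsZero (((Tor (ModuleCat.{u} R) n).obj M).obj N)

/-- `C` is a semidualizing `R`-module. -/
structure IsSemidualizing (C : ModuleCat.{u} R) : Prop where
  /-- `C` has a (possibly unbounded) resolution by free modules of finite rank. -/
  exists_resolution : ∃ F : ProjectiveResolution C,
    ∀ n : ℕ, Module.Free R (F.complex.X n) ∧ Module.Finite R (F.complex.X n)
  /-- The homothety map `R → Hom(C, C)` is an isomorphism. -/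
  homothety_bijective : Function.Bijective (LinearMap.lsmul R C)
  ext_vanish : ExtVanish C C

/-- The finitely generated modules in `𝒳`. -/
def fg (𝒳 : ObjectProperty (ModuleCat.{u} R)) : ObjectProperty (ModuleCat.{u} R) :=
  fun M => 𝒳 M ∧ Module.Finite R M

/-- The `C`-projective modules: `P ⊗ C` with `P` projective. -/
def cProjective (C : ModuleCat.{u} R) : ObjectProperty (ModuleCat.{u} R) :=
  fun M => ∃ P : ModuleCat.{u} R, Module.Projective R P ∧
    Nonempty (M ≅ ModuleCat.of R (P ⊗[R] C))

/-- The `C`-injective modules: `Hom(C, I)` with `I` injective. -/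
def cInjective (C : ModuleCat.{u} R) : ObjectProperty (ModuleCat.{u} R) :=
  fun M => ∃ I : ModuleCat.{u} R, Module.Injective R I ∧
    Nonempty (M ≅ ModuleCat.of R (C →ₗ[R] I))

/-- Complete `𝒫𝒫_C`-resolutions. -/
structure IsCompletePPCResolution (C : ModuleCat.{u} R)
    (X : ChainComplex (ModuleCat.{u} R) ℤ) : Prop where
  exact : X.Acyclic
  homTo_exact : ∀ B : ModuleCat.{u} R, cProjective C B → HomToExact X B
  projective : ∀ i : ℤ, 0 ≤ i → Module.Projective R (X.X i)
  cProjective : ∀ i : ℤ, i < 0 → cProjective C (X.X i)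

/-- The `G_C`-projective modules. -/
def gcProjective (C : ModuleCat.{u} R) : ObjectProperty (ModuleCat.{u} R) :=
  fun M => ∃ X : ChainComplex (ModuleCat.{u} R) ℤ,
    IsCompletePPCResolution C X ∧ Nonempty (M ≅ cokernel (X.d 1 0))

/-- Complete `ℐ_Cℐ`-coresolutions. -/
structure IsCompleteICICoresolution (C : ModuleCat.{u} R)
    (Y : ChainComplex (ModuleCat.{u} R) ℤ) : Prop where
  exact : Y.Acyclic
  homFrom_exact : ∀ A : ModuleCat.{u} R, cInjective C A → HomFromExact A Y
  injective : ∀ i : ℤ, i ≤ 0 → Module.Injective R (Y.X i)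
  cInjective : ∀ i : ℤ, 0 < i → cInjective C (Y.X i)

/-- The `G_C`-injective modules. -/
def gcInjective (C : ModuleCat.{u} R) : ObjectProperty (ModuleCat.{u} R) :=
  fun N => ∃ Y : ChainComplex (ModuleCat.{u} R) ℤ,
    IsCompleteICICoresolution C Y ∧ Nonempty (N ≅ kernel (Y.d 0 (-1)))

/-- The totally `C`-reflexive modules (a notion used over a noetherian ring). -/
structure IsTotallyReflexive (C H : ModuleCat.{u} R) : Prop where
  finite : Module.Finite R H
  ext_vanish : ExtVanish H C
  ext_dual_vanish : ExtVanish (ModuleCat.of R (H →ₗ[R] C)) C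
  /-- The biduality map `h ↦ (φ ↦ φ h)` is an isomorphism. -/
  biduality_bijective :
    Function.Bijective (LinearMap.applyₗ : H →ₗ[R] (H →ₗ[R] C) →ₗ[R] C)

/-- The subcategory of totally `C`-reflexive modules. -/
def totallyReflexive (C : ModuleCat.{u} R) : ObjectProperty (ModuleCat.{u} R) :=
  fun H => IsTotallyReflexive C H

/-- Membership in the Auslander class of `C`. -/
structure InAuslanderClass (C M : ModuleCat.{u} R) : Prop where
  tor_vanish : TorVanish C M
  ext_vanish : ExtVanish C (ModuleCat.of R (C ⊗[R] M))
  /-- The natural map `m ↦ (c ↦ c ⊗ m)` is an isomorphism. -/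
  unit_bijective :
    Function.Bijective ((TensorProduct.mk R C M).flip : M →ₗ[R] C →ₗ[R] C ⊗[R] M)

/-- The Auslander class of `C`. -/
def auslanderClass (C : ModuleCat.{u} R) : ObjectProperty (ModuleCat.{u} R) :=
  fun M => InAuslanderClass C M

/-- Membership in the Bass class of `C`. -/
structure InBassClass (C N : ModuleCat.{u} R) : Prop where
  ext_vanish : ExtVanish C N
  tor_vanish : TorVanish C (ModuleCat.of R (C →ₗ[R] N))
  /-- The evaluation map `c ⊗ φ ↦ φ c` is an isomorphism. -/
  evaluation_bijective :
    Function.Bijective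
      (TensorProduct.lift (LinearMap.applyₗ : C →ₗ[R] (C →ₗ[R] N) →ₗ[R] N))

/-- The Bass class of `C`. -/
def bassClass (C : ModuleCat.{u} R) : ObjectProperty (ModuleCat.{u} R) :=
  fun N => InBassClass C N

end GorensteinCat

end

noncomputable section

namespace GorensteinCat

variable {R : Type u} [CommRing R]

/-! A complex is cut into short exact sequences 0 → W (n+1) → X n → W n → 0 (`Step`). Exactness of
its Hom complexes becomes a lifting or extension property of these sequences, controlled by an Ext¹.
The rest is dimension shifting, powered by the vanishing of Ext^{≥1} between C-projectives and
between C-injectives (`extZero_cProjective`, `extZero_cInjective`); this comes from the finite free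
resolution of C and Ext^{≥1}(C, C) = 0.

Let the X n be C-projective with both Hom conditions. Exactness of Hom(C, -) gives Ext^{≥1}(C, W n)
= 0. The evaluation map is bijective on each X n, hence on each W n by diagram chase. The sequences
Hom(C, -) have projective middle terms and stay exact under C ⊗ -, which kills Tor; so W n lies in
the Bass class (`bassClass_of_steps`). The other Hom condition gives Ext^{≥1}(W 0, Q) = 0 for
C-projective Q, so the left half can be exchanged for any projective resolution of W 0, which is
therefore G_C-projective.

Conversely, let M be G_C-projective and in the Bass class. Then Hom(C, M) is in the Auslander class,
and C ⊗ - turns a projective resolution of it into a resolution of M by C-projectives with both Hom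
conditions (`auslanderClass_step`). The right half given by G_C-projectivity already consists of
C-projectives; it is Hom(C, -)-exact because Ext^{≥1}(C, M) = 0 passes to cosyzygies. The injective
statement is dual: C ⊗ M is embedded into injectives and Hom(C, -) is applied (`bassClass_step`).

In the noetherian case the left half is built in the same way from finite free modules. No right
half is given; it is obtained by covering Hom(M, C) by a finite free module, dualizing into C and
using biduality (`totallyReflexive_step`). -/

open Abelian in
/-- `Ext^n_R(M, N) = 0`, for unbundled modules. -/
def ExtZero (R : Type u) [CommRing R] (n : ℕ) (M N : Type u) [AddCommGroup M] [Module R M]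
    [AddCommGroup N] [Module R N] : Prop :=
  Subsingleton (Ext.{u} (ModuleCat.of R M) (ModuleCat.of R N) n)

/-- A short exact sequence of modules `0 → K → X → M → 0`. -/
structure IsSES {K X M : Type u} [AddCommGroup K] [Module R K] [AddCommGroup X] [Module R X]
    [AddCommGroup M] [Module R M] (f : K →ₗ[R] X) (g : X →ₗ[R] M) : Prop where
  inj : Function.Injective f
  exact : Function.Exact f g
  surj : Function.Surjective g

theorem extVanish_iff (M N : ModuleCat.{u} R) :
    ExtVanish M N ↔ ∀ n, ExtZero R (n + 1) M N :=
  ⟨fun h n => h (n + 1) (by omega), fun h n hn => by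
    obtain ⟨k, rfl⟩ : ∃ k, n = k + 1 := ⟨n - 1, by omega⟩
    exact h k⟩

/-! ### Dimension shifting for Ext along a short exact sequence -/

section

variable {K X M A B N : Type u} [AddCommGroup K] [Module R K] [AddCommGroup X] [Module R X]
  [AddCommGroup M] [Module R M] [AddCommGroup A] [Module R A] [AddCommGroup B] [Module R B]
  [AddCommGroup N] [Module R N]

theorem ExtZero.congr_left {n : ℕ} (e : M ≃ₗ[R] N) (h : ExtZero R n M A) : ExtZero R n N A := by
  have := h
  unfold ExtZero at *
  refine ⟨fun x y => ?_⟩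
  have key : ∀ z : Abelian.Ext.{u} (ModuleCat.of R N) (ModuleCat.of R A) n, z = 0 := fun z => by
    have h1 := Subsingleton.elim
      ((Abelian.Ext.mk₀ (ModuleCat.ofHom e.toLinearMap)).comp z (zero_add n)) 0
    have h2 := congrArg
      (fun w => (Abelian.Ext.mk₀ (ModuleCat.ofHom e.symm.toLinearMap)).comp w (zero_add n)) h1
    simp only [Abelian.Ext.mk₀_comp_mk₀_assoc, Abelian.Ext.comp_zero] at h2
    rw [← ModuleCat.ofHom_comp] at h2
    simpa using h2
  rw [key x, key y]

theorem ExtZero.congr_right {n : ℕ} (e : M ≃ₗ[R] N) (h : ExtZero R n A M) : ExtZero R n A N := by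
  have := h
  unfold ExtZero at *
  refine ⟨fun x y => ?_⟩
  have key : ∀ z : Abelian.Ext.{u} (ModuleCat.of R A) (ModuleCat.of R N) n, z = 0 := fun z => by
    have h1 := Subsingleton.elim
      (z.comp (Abelian.Ext.mk₀ (ModuleCat.ofHom e.symm.toLinearMap)) (add_zero n)) 0
    have h2 := congrArg
      (fun w => w.comp (Abelian.Ext.mk₀ (ModuleCat.ofHom e.toLinearMap)) (add_zero n)) h1
    simp only [Abelian.Ext.comp_assoc_of_second_deg_zero, Abelian.Ext.mk₀_comp_mk₀,
      Abelian.Ext.zero_comp] at h2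
    rw [← ModuleCat.ofHom_comp] at h2
    simpa using h2
  rw [key x, key y]

theorem extZero_of_projective [Module.Projective R M] (n : ℕ) : ExtZero R (n + 1) M N :=
  haveI : Projective (ModuleCat.of R M) := (IsProjective.iff_projective M).1 inferInstance
  Abelian.Ext.subsingleton_of_projective _ _ _

theorem extZero_of_injective (hN : Module.Injective R N) (n : ℕ) : ExtZero R (n + 1) M N :=
  haveI : Injective (ModuleCat.of R N) := Module.injective_object_of_injective_module R N
  Abelian.Ext.subsingleton_of_injective _ _ _

namespace IsSES

/-- The short exact sequence as a short complex. -/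
abbrev toShortComplex {f : K →ₗ[R] X} {g : X →ₗ[R] M} (h : IsSES f g) :
    ShortComplex (ModuleCat.{u} R) :=
  ShortComplex.mk (ModuleCat.ofHom f) (ModuleCat.ofHom g) (by
    ext x; exact h.exact.apply_apply_eq_zero x)

theorem shortExact {f : K →ₗ[R] X} {g : X →ₗ[R] M} (h : IsSES f g) :
    h.toShortComplex.ShortExact :=
  ModuleCat.shortComplex_shortExact _ h.exact h.inj h.surj

variable {f : K →ₗ[R] X} {g : X →ₗ[R] M}

theorem exists_extend (h : IsSES f g) (h1 : ExtZero R 1 M B) (φ : K →ₗ[R] B) :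
    ∃ ψ : X →ₗ[R] B, ψ ∘ₗ f = φ := by
  have := h1
  unfold ExtZero at this
  obtain ⟨y, hy⟩ := Abelian.Ext.contravariant_sequence_exact₁ h.shortExact _
    (Abelian.Ext.mk₀ (ModuleCat.ofHom φ)) (add_zero 1) (Subsingleton.elim _ _)
  obtain ⟨ψ, rfl⟩ := Abelian.Ext.homEquiv₀.symm.surjective y
  refine ⟨ψ.hom, ?_⟩
  have h2 : Abelian.Ext.mk₀ (ModuleCat.ofHom f ≫ ψ) = Abelian.Ext.mk₀ (ModuleCat.ofHom φ) := by
    rw [← hy]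
    simp
  have h3 := (Abelian.Ext.mk₀_bijective _ _).1 h2
  exact congrArg ModuleCat.Hom.hom h3

theorem exists_lift (h : IsSES f g) (h1 : ExtZero R 1 A K) (φ : A →ₗ[R] M) :
    ∃ ψ : A →ₗ[R] X, g ∘ₗ ψ = φ := by
  have := h1
  unfold ExtZero at this
  obtain ⟨y, hy⟩ := Abelian.Ext.covariant_sequence_exact₃ _ h.shortExact
    (Abelian.Ext.mk₀ (ModuleCat.ofHom φ)) (zero_add 1) (Subsingleton.elim _ _)
  obtain ⟨ψ, rfl⟩ := Abelian.Ext.homEquiv₀.symm.surjective y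
  refine ⟨ψ.hom, ?_⟩
  have h2 : Abelian.Ext.mk₀ (ψ ≫ ModuleCat.ofHom g) = Abelian.Ext.mk₀ (ModuleCat.ofHom φ) := by
    rw [← hy]
    simp
  have h3 := (Abelian.Ext.mk₀_bijective _ _).1 h2
  exact congrArg ModuleCat.Hom.hom h3

theorem ext_right_of_mid (h : IsSES f g) {n : ℕ} (h1 : ExtZero R n K B)
    (h2 : ExtZero R (n + 1) X B) : ExtZero R (n + 1) M B := by
  have := h1
  have := h2
  unfold ExtZero at *
  have key : ∀ z : Abelian.Ext.{u} (ModuleCat.of R M) (ModuleCat.of R B) (n + 1), z = 0 :=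
    fun z => by
      obtain ⟨y, hy⟩ := Abelian.Ext.contravariant_sequence_exact₃ h.shortExact _ z
        (Subsingleton.elim _ _) (add_comm 1 n)
      rw [← hy, Subsingleton.elim y 0, Abelian.Ext.comp_zero]
  exact ⟨fun x y => by rw [key x, key y]⟩

theorem ext_left_of_mid (h : IsSES f g) {n : ℕ} (h1 : ExtZero R n X B)
    (h2 : ExtZero R (n + 1) M B) : ExtZero R n K B := by
  have := h1
  have := h2
  unfold ExtZero at *
  have key : ∀ z : Abelian.Ext.{u} (ModuleCat.of R K) (ModuleCat.of R B) n, z = 0 :=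
    fun z => by
      obtain ⟨y, hy⟩ := Abelian.Ext.contravariant_sequence_exact₁ h.shortExact _ z
        (add_comm 1 n) (Subsingleton.elim _ _)
      rw [← hy, Subsingleton.elim y 0, Abelian.Ext.comp_zero]
  exact ⟨fun x y => by rw [key x, key y]⟩

/-- Base case of the shifts: `ext_right_of_mid` at n = 0 would ask for Hom(K, B) = 0. A class in
Ext¹(M, B) is the image of some φ : K → B under the connecting map, and this image is zero as soon
as φ extends to X. -/
theorem ext_one_right (h : IsSES f g) (h1 : ExtZero R 1 X B)
    (h2 : ∀ φ : K →ₗ[R] B, ∃ ψ : X →ₗ[R] B, ψ ∘ₗ f = φ) : ExtZero R 1 M B := by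
  have := h1
  unfold ExtZero at *
  have key : ∀ z : Abelian.Ext.{u} (ModuleCat.of R M) (ModuleCat.of R B) 1, z = 0 :=
    fun z => by
      obtain ⟨y, hy⟩ := Abelian.Ext.contravariant_sequence_exact₃ h.shortExact _ z
        (Subsingleton.elim _ _) (add_zero 1)
      obtain ⟨φ, rfl⟩ := Abelian.Ext.homEquiv₀.symm.surjective y
      obtain ⟨ψ, hψ⟩ := h2 φ.hom
      have h3 : φ = ModuleCat.ofHom f ≫ ModuleCat.ofHom ψ := by
        ext x; exact (LinearMap.congr_fun hψ x).symm
      rw [← hy, h3]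
      simp only [Abelian.Ext.homEquiv₀_symm_apply]
      rw [← Abelian.Ext.mk₀_comp_mk₀]
      exact h.shortExact.extClass_comp_assoc _
  exact ⟨fun x y => by rw [key x, key y]⟩

theorem ext_one_left (h : IsSES f g) (h1 : ExtZero R 1 A X)
    (h2 : ∀ φ : A →ₗ[R] M, ∃ ψ : A →ₗ[R] X, g ∘ₗ ψ = φ) : ExtZero R 1 A K := by
  have := h1
  unfold ExtZero at *
  have key : ∀ z : Abelian.Ext.{u} (ModuleCat.of R A) (ModuleCat.of R K) 1, z = 0 :=
    fun z => by
      obtain ⟨y, hy⟩ := Abelian.Ext.covariant_sequence_exact₁ _ h.shortExact z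
        (Subsingleton.elim _ _) (zero_add 1)
      obtain ⟨φ, rfl⟩ := Abelian.Ext.homEquiv₀.symm.surjective y
      obtain ⟨ψ, hψ⟩ := h2 φ.hom
      have h3 : φ = ModuleCat.ofHom ψ ≫ ModuleCat.ofHom g := by
        ext x; exact (LinearMap.congr_fun hψ x).symm
      rw [← hy, h3]
      simp only [Abelian.Ext.homEquiv₀_symm_apply]
      rw [← Abelian.Ext.mk₀_comp_mk₀, Abelian.Ext.comp_assoc_of_second_deg_zero]
      erw [h.shortExact.comp_extClass]
      rw [Abelian.Ext.comp_zero]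
  exact ⟨fun x y => by rw [key x, key y]⟩

theorem ext_to_left_of_mid (h : IsSES f g) {n : ℕ} (h1 : ExtZero R n A M)
    (h2 : ExtZero R (n + 1) A X) : ExtZero R (n + 1) A K := by
  have := h1
  have := h2
  unfold ExtZero at *
  have key : ∀ z : Abelian.Ext.{u} (ModuleCat.of R A) (ModuleCat.of R K) (n + 1), z = 0 :=
    fun z => by
      obtain ⟨y, hy⟩ := Abelian.Ext.covariant_sequence_exact₁ _ h.shortExact z
        (Subsingleton.elim _ _) rfl
      rw [← hy, Subsingleton.elim y 0, Abelian.Ext.zero_comp]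
  exact ⟨fun x y => by rw [key x, key y]⟩

theorem ext_to_right_of_mid (h : IsSES f g) {n : ℕ} (h1 : ExtZero R n A X)
    (h2 : ExtZero R (n + 1) A K) : ExtZero R n A M := by
  have := h1
  have := h2
  unfold ExtZero at *
  have key : ∀ z : Abelian.Ext.{u} (ModuleCat.of R A) (ModuleCat.of R M) n, z = 0 :=
    fun z => by
      obtain ⟨y, hy⟩ := Abelian.Ext.covariant_sequence_exact₃ _ h.shortExact z
        rfl (Subsingleton.elim _ _)
      rw [← hy, Subsingleton.elim y 0, Abelian.Ext.zero_comp]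
  exact ⟨fun x y => by rw [key x, key y]⟩

end IsSES

end

/-! ### Complexes as two-sided chains of short exact sequences -/

/-- There is a short exact sequence `0 → K → X → M → 0` with `X` in `𝒳` on which `Hom(A, -)` is
exact for all `A` in `𝒜` and `Hom(-, B)` is exact for all `B` in `ℬ`. -/
def Step (𝒳 𝒜 ℬ : ObjectProperty (ModuleCat.{u} R)) (K M : ModuleCat.{u} R) : Prop :=
  ∃ (X : ModuleCat.{u} R) (f : K →ₗ[R] X) (g : X →ₗ[R] M), 𝒳 X ∧ IsSES f g ∧
    (∀ A, 𝒜 A → ∀ φ : A →ₗ[R] M, ∃ ψ : A →ₗ[R] X, g ∘ₗ ψ = φ) ∧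
    (∀ B, ℬ B → ∀ φ : K →ₗ[R] B, ∃ ψ : X →ₗ[R] B, ψ ∘ₗ f = φ)

theorem Step.mono {𝒳 𝒜 ℬ 𝒳' 𝒜' ℬ' : ObjectProperty (ModuleCat.{u} R)} {K M : ModuleCat.{u} R}
    (h : Step 𝒳 𝒜 ℬ K M) (h𝒳 : ∀ X, 𝒳 X → 𝒳' X) (h𝒜 : ∀ X, 𝒜' X → 𝒜 X)
    (hℬ : ∀ X, ℬ' X → ℬ X) : Step 𝒳' 𝒜' ℬ' K M := by
  obtain ⟨X, f, g, h1, h2, h3, h4⟩ := h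
  exact ⟨X, f, g, h𝒳 _ h1, h2, fun A hA => h3 A (h𝒜 _ hA), fun B hB => h4 B (hℬ _ hB)⟩

section

variable (X : ChainComplex (ModuleCat.{u} R) ℤ)

theorem homFromExact_iff (A : ModuleCat.{u} R) : HomFromExact A X ↔
    ∀ m : ℤ, Function.Exact (fun f : A ⟶ X.X (m + 1 + 1) => f ≫ X.d (m + 1 + 1) (m + 1))
      (fun f : A ⟶ X.X (m + 1) => f ≫ X.d (m + 1) m) := by
  have key : ∀ j k : ℤ, k = j - 1 → (Function.Exact (fun f : A ⟶ X.X (j + 1) => f ≫ X.d (j + 1) j)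
      (fun f : A ⟶ X.X j => f ≫ X.d j k) ↔
      Function.Exact (fun f : A ⟶ X.X (j + 1) => f ≫ X.d (j + 1) j)
      (fun f : A ⟶ X.X j => f ≫ X.d j (j - 1))) := by
    rintro j k rfl; rfl
  constructor
  · exact fun h m => (key _ _ (by ring)).2 (h (m + 1))
  · intro h n
    obtain ⟨m, rfl⟩ : ∃ m, n = m + 1 := ⟨n - 1, by ring⟩
    exact (key _ _ (by ring)).1 (h m)

theorem homToExact_iff (B : ModuleCat.{u} R) : HomToExact X B ↔
    ∀ m : ℤ, Function.Exact (fun f : X.X m ⟶ B => X.d (m + 1) m ≫ f)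
      (fun f : X.X (m + 1) ⟶ B => X.d (m + 1 + 1) (m + 1) ≫ f) := by
  have key : ∀ j k : ℤ, k = j - 1 → (Function.Exact (fun f : X.X k ⟶ B => X.d j k ≫ f)
      (fun f : X.X j ⟶ B => X.d (j + 1) j ≫ f) ↔
      Function.Exact (fun f : X.X (j - 1) ⟶ B => X.d j (j - 1) ≫ f)
      (fun f : X.X j ⟶ B => X.d (j + 1) j ≫ f)) := by
    rintro j k rfl; rfl
  constructor
  · exact fun h m => (key _ _ (by ring)).2 (h (m + 1))
  · intro h n
    obtain ⟨m, rfl⟩ : ∃ m, n = m + 1 := ⟨n - 1, by ring⟩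
    exact (key _ _ (by ring)).1 (h m)

theorem acyclic_iff : X.Acyclic ↔
    ∀ m : ℤ, Function.Exact (X.d (m + 1 + 1) (m + 1)).hom (X.d (m + 1) m).hom := by
  have key : ∀ m : ℤ, X.ExactAt (m + 1) ↔
      Function.Exact (X.d (m + 1 + 1) (m + 1)).hom (X.d (m + 1) m).hom := fun m => by
    rw [X.exactAt_iff' (m + 1 + 1) (m + 1) m (by simp) (by simp)]
    exact ShortComplex.ShortExact.moduleCat_exact_iff_function_exact _
  constructor
  · exact fun h m => (key m).1 (h _)
  · intro h n
    obtain ⟨m, rfl⟩ : ∃ m, n = m + 1 := ⟨n - 1, by ring⟩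
    exact (key m).2 (h m)

/-- W n is the cokernel of X (n+1) → X n; acyclicity makes the induced map W (n+1) → X n injective.
A map A → W n followed by W n → X (n-1) is a cycle of Hom(A, X), and exactness lifts it; extensions
are dual. With this indexing the cokernel of d 1 0 is W 0 and the kernel of d 0 (-1) is W 1. -/
theorem exists_steps_of_complex (𝒳 : ℤ → ObjectProperty (ModuleCat.{u} R))
    (𝒜 ℬ : ObjectProperty (ModuleCat.{u} R)) (hX : X.Acyclic) (h𝒳 : ∀ n, 𝒳 n (X.X n))
    (h𝒜 : ∀ A, 𝒜 A → HomFromExact A X) (hℬ : ∀ B, ℬ B → HomToExact X B) :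
    ∃ W : ℤ → ModuleCat.{u} R, (∀ n, Step (𝒳 n) 𝒜 ℬ (W (n + 1)) (W n)) ∧
      Nonempty (W 0 ≅ cokernel (X.d 1 0)) ∧ Nonempty (W 1 ≅ kernel (X.d 0 (-1))) := by
  rw [acyclic_iff] at hX
  have hle : ∀ m : ℤ, LinearMap.range (X.d (m + 1 + 1) (m + 1)).hom ≤
      LinearMap.ker (X.d (m + 1) m).hom := fun m =>
    le_of_eq (LinearMap.exact_iff.1 (hX m)).symm
  let W : ℤ → ModuleCat.{u} R := fun n =>
    ModuleCat.of R (X.X n ⧸ LinearMap.range (X.d (n + 1) n).hom)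
  let f : ∀ n, W (n + 1) →ₗ[R] X.X n := fun n => Submodule.liftQ _ (X.d (n + 1) n).hom (hle n)
  let g : ∀ n, X.X n →ₗ[R] W n := fun n => Submodule.mkQ _
  have hfg : ∀ n x, f n (g (n + 1) x) = (X.d (n + 1) n).hom x := fun n x => rfl
  have hg : ∀ n, Function.Surjective (g n) := fun n => Submodule.mkQ_surjective _
  have hg0 : ∀ n x, g n x = 0 ↔ ∃ y, (X.d (n + 1) n).hom y = x := fun n x =>
    (Submodule.Quotient.mk_eq_zero _).trans LinearMap.mem_range
  have hf : ∀ n, Function.Injective (f n) := fun n => by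
    rw [injective_iff_map_eq_zero]
    intro w hw
    obtain ⟨x, rfl⟩ := hg _ w
    rw [hfg] at hw
    exact (hg0 _ _).2 ((hX n x).1 hw)
  have hses : ∀ n, IsSES (f n) (g n) := fun n => by
    refine ⟨hf n, fun x => ?_, hg n⟩
    rw [hg0]
    constructor
    · rintro ⟨y, rfl⟩
      exact ⟨g (n + 1) y, hfg n y⟩
    · rintro ⟨w, rfl⟩
      obtain ⟨y, rfl⟩ := hg _ w
      exact ⟨y, (hfg n y).symm⟩
  refine ⟨W, fun n => ⟨X.X n, f n, g n, h𝒳 n, hses n, fun A hA φ => ?_, fun B hB φ => ?_⟩, ?_, ?_⟩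
  · obtain ⟨m, rfl⟩ : ∃ m, n = m + 1 := ⟨n - 1, by ring⟩
    obtain ⟨k, rfl⟩ : ∃ k, m = k + 1 := ⟨m - 1, by ring⟩
    have h := (homFromExact_iff X A).1 (h𝒜 A hA) k (ModuleCat.ofHom (f (k + 1) ∘ₗ φ))
    obtain ⟨ψ, hψ⟩ := h.1 (by
      ext a
      obtain ⟨y, hy⟩ := hg _ (φ a)
      have h1 : (X.d (k + 1) k).hom (f (k + 1) (φ a)) = 0 := by
        rw [← hy, hfg]
        exact (hX k).apply_apply_eq_zero y
      exact h1)
    refine ⟨ψ.hom, ?_⟩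
    ext a
    apply hf
    have h1 := LinearMap.congr_fun (congrArg ModuleCat.Hom.hom hψ) a
    rw [LinearMap.comp_apply, hfg]
    exact h1
  · have h := (homToExact_iff X B).1 (hℬ B hB) n (ModuleCat.ofHom (φ ∘ₗ g (n + 1)))
    obtain ⟨ψ, hψ⟩ := h.1 (by
      ext a
      have h1 : g (n + 1) ((X.d (n + 1 + 1) (n + 1)).hom a) = 0 := (hg0 _ _).2 ⟨a, rfl⟩
      have h2 : φ (g (n + 1) ((X.d (n + 1 + 1) (n + 1)).hom a)) = 0 := by rw [h1, map_zero]
      exact h2)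
    refine ⟨ψ.hom, ?_⟩
    refine LinearMap.ext fun w => ?_
    obtain ⟨x, rfl⟩ := hg _ w
    rw [LinearMap.comp_apply, hfg]
    exact LinearMap.congr_fun (congrArg ModuleCat.Hom.hom hψ) x
  · exact ⟨(ModuleCat.cokernelIsoRangeQuotient (X.d 1 0)).symm⟩
  · have hker : LinearMap.ker (X.d 0 (-1)).hom = LinearMap.range (f 0) := by
      have h1 : ∀ k : ℤ, k + 1 = 0 → Function.Exact (X.d (0 + 1) 0).hom (X.d 0 k).hom := by
        intro k hk
        obtain rfl : k = -1 := by omega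
        exact hX (-1)
      ext x
      have h2 := (hses 0).exact x
      rw [hg0] at h2
      exact (h1 _ (by norm_num) x).trans h2
    exact ⟨(LinearEquiv.ofInjective _ (hf 0)).toModuleIso ≪≫
      (LinearEquiv.ofEq _ _ hker.symm).toModuleIso ≪≫
      (ModuleCat.kernelIsoKer (X.d 0 (-1))).symm⟩

end

/-- Splicing: the differential is X (n+1) → W (n+1) → X n, and the lifting and extension properties
give back the exactness of the Hom complexes. -/
theorem exists_complex_of_steps (W : ℤ → ModuleCat.{u} R)
    (𝒳 : ℤ → ObjectProperty (ModuleCat.{u} R)) (𝒜 ℬ : ObjectProperty (ModuleCat.{u} R))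
    (hW : ∀ n, Step (𝒳 n) 𝒜 ℬ (W (n + 1)) (W n)) :
    ∃ X : ChainComplex (ModuleCat.{u} R) ℤ, X.Acyclic ∧ (∀ n, 𝒳 n (X.X n)) ∧
      (∀ A, 𝒜 A → HomFromExact A X) ∧ (∀ B, ℬ B → HomToExact X B) ∧
      Nonempty (W 0 ≅ cokernel (X.d 1 0)) ∧ Nonempty (W 1 ≅ kernel (X.d 0 (-1))) := by
  choose X f g h𝒳 hses h𝒜 hℬ using hW
  let d : ∀ n, X (n + 1) ⟶ X n := fun n => ModuleCat.ofHom (f n ∘ₗ g (n + 1))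
  have hd0 : ∀ n, d (n + 1) ≫ d n = 0 := fun n => by
    ext x
    have h1 : f n (g (n + 1) (f (n + 1) (g (n + 1 + 1) x))) = 0 := by
      rw [(hses (n + 1)).exact.apply_apply_eq_zero, map_zero]
    exact h1
  let Y : ChainComplex (ModuleCat.{u} R) ℤ := ChainComplex.of X d hd0
  have hd : ∀ n, Y.d (n + 1) n = d n := fun n => ChainComplex.of_d X d n
  have hex : ∀ m, Function.Exact (d (m + 1)).hom (d m).hom := fun m x => by
    have h1 := (hses (m + 1)).exact x
    have h2 : f m (g (m + 1) x) = 0 ↔ g (m + 1) x = 0 := by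
      rw [← (hses m).inj.eq_iff, map_zero]
    refine (h2.trans h1).trans ⟨?_, ?_⟩
    · rintro ⟨w, rfl⟩
      obtain ⟨y, rfl⟩ := (hses _).surj w
      exact ⟨y, rfl⟩
    · rintro ⟨y, rfl⟩
      exact ⟨_, rfl⟩
  refine ⟨Y, ?_, h𝒳, fun A hA => ?_, fun B hB => ?_, ?_, ?_⟩
  · rw [acyclic_iff]
    intro m
    rw [hd, hd]
    exact hex m
  · rw [homFromExact_iff]
    intro m
    rw [hd, hd]
    intro φ
    constructor
    · intro hφ
      have h0 : ∀ a, g (m + 1) (φ.hom a) = 0 := fun a => by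
        apply (hses m).inj
        rw [map_zero]
        exact LinearMap.congr_fun (congrArg ModuleCat.Hom.hom hφ) a
      let ι := LinearEquiv.ofInjective _ (hses (m + 1)).inj
      obtain ⟨ψ, hψ⟩ := h𝒜 (m + 1 + 1) A hA (ι.symm.toLinearMap ∘ₗ
        LinearMap.codRestrict _ φ.hom (fun a => ((hses (m + 1)).exact _).1 (h0 a)))
      refine ⟨ModuleCat.ofHom ψ, ?_⟩
      ext a
      have h1 : f (m + 1) (g (m + 1 + 1) (ψ a)) = φ.hom a := by
        rw [← LinearMap.comp_apply (g _), hψ]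
        exact congrArg Subtype.val (ι.apply_symm_apply _)
      exact h1
    · rintro ⟨ψ, rfl⟩
      change (ψ ≫ d (m + 1)) ≫ d m = 0
      rw [Category.assoc, hd0, comp_zero]
  · rw [homToExact_iff]
    intro m
    rw [hd, hd]
    intro φ
    constructor
    · intro hφ
      have h0 : ∀ x, g (m + 1) x = 0 → φ.hom x = 0 := fun x hx => by
        obtain ⟨w, rfl⟩ := ((hses (m + 1)).exact x).1 hx
        obtain ⟨y, rfl⟩ := (hses _).surj w
        exact LinearMap.congr_fun (congrArg ModuleCat.Hom.hom hφ) y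
      let ι := LinearMap.quotKerEquivOfSurjective _ (hses (m + 1)).surj
      obtain ⟨ψ, hψ⟩ := hℬ m B hB ((Submodule.liftQ _ φ.hom h0) ∘ₗ ι.symm.toLinearMap)
      refine ⟨ModuleCat.ofHom ψ, ?_⟩
      ext x
      have h1 : ψ (f m (g (m + 1) x)) = φ.hom x := by
        rw [← LinearMap.comp_apply, hψ]
        have h2 : ι.symm (g (m + 1) x) = Submodule.Quotient.mk x := by
          rw [LinearEquiv.symm_apply_eq]; rfl
        rw [LinearMap.comp_apply, LinearEquiv.coe_coe, h2]
        rfl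
      exact h1
    · rintro ⟨ψ, rfl⟩
      change d (m + 1) ≫ d m ≫ ψ = 0
      rw [← Category.assoc, hd0, zero_comp]
  · have hr : LinearMap.range (Y.d 1 0).hom = LinearMap.ker (g 0) := by
      rw [show Y.d 1 0 = d 0 from hd 0]
      ext x
      rw [LinearMap.mem_ker, (hses 0).exact x]
      constructor
      · rintro ⟨y, rfl⟩
        exact ⟨_, rfl⟩
      · rintro ⟨w, rfl⟩
        obtain ⟨y, rfl⟩ := (hses _).surj w
        exact ⟨y, rfl⟩
    exact ⟨(LinearMap.quotKerEquivOfSurjective _ (hses 0).surj).symm.toModuleIso ≪≫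
      (Submodule.quotEquivOfEq _ _ hr.symm).toModuleIso ≪≫
      (ModuleCat.cokernelIsoRangeQuotient (Y.d 1 0)).symm⟩
  · have hr : LinearMap.range (f 0) = LinearMap.ker (Y.d 0 (-1)).hom := by
      have h1 : ∀ j k : ℤ, k + 1 = j → LinearMap.range (f j) = LinearMap.ker (Y.d j k).hom := by
        rintro j k rfl
        rw [hd]
        ext x
        refine ((hses (k + 1)).exact x).symm.trans ?_
        rw [← (hses k).inj.eq_iff, map_zero]
        rfl
      exact h1 _ _ (by norm_num)
    exact ⟨(LinearEquiv.ofInjective _ (hses 0).inj).toModuleIso ≪≫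
      (LinearEquiv.ofEq _ _ hr).toModuleIso ≪≫
      (ModuleCat.kernelIsoKer (Y.d 0 (-1))).symm⟩

/-- Dependent choice; S is the invariant that lets the construction of a half-resolution continue.
-/
theorem exists_seq_of_forall {α : Type*} (S : α → Prop) (r : α → α → Prop)
    (h : ∀ a, S a → ∃ b, S b ∧ r a b) (a : α) (ha : S a) :
    ∃ L : ℕ → α, L 0 = a ∧ ∀ n, r (L n) (L (n + 1)) := by
  choose F hF1 hF2 using h
  let L : ℕ → {a // S a} := fun n => Nat.rec ⟨a, ha⟩ (fun _ x => ⟨F x.1 x.2, hF1 x.1 x.2⟩) n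
  exact ⟨fun n => (L n).1, rfl, fun n => hF2 (L n).1 (L n).2⟩

theorem exists_int_seq {α : Type*} {p q : α → α → Prop} (L K : ℕ → α) (h0 : L 0 = K 0)
    (hL : ∀ n, p (L (n + 1)) (L n)) (hK : ∀ n, q (K n) (K (n + 1))) :
    ∃ W : ℤ → α, W 0 = L 0 ∧ (∀ n, 0 ≤ n → p (W (n + 1)) (W n)) ∧
      ∀ n, n < 0 → q (W (n + 1)) (W n) := by
  obtain ⟨W, hpos, hneg⟩ : ∃ W : ℤ → α, (∀ n : ℕ, W n = L n) ∧ ∀ n : ℕ, W (-n) = K n := by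
    refine ⟨fun m => if 0 ≤ m then L m.toNat else K (-m).toNat, fun n => by simp, fun n => ?_⟩
    rcases n with _ | n
    · simpa using h0
    · have h1 : ¬ (0 : ℤ) ≤ -((n + 1 : ℕ) : ℤ) := by omega
      simp only [h1, if_false]
      congr 1
  refine ⟨W, by simpa using hpos 0, fun n hn => ?_, fun n hn => ?_⟩
  · obtain ⟨m, rfl⟩ := Int.eq_ofNat_of_zero_le hn
    have h1 := hpos (m + 1)
    push_cast at h1
    rw [h1, hpos]
    exact hL m
  · obtain ⟨m, rfl⟩ : ∃ m : ℕ, n = -((m + 1 : ℕ) : ℤ) := ⟨(-n - 1).toNat, by omega⟩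
    rw [hneg, show -((m + 1 : ℕ) : ℤ) + 1 = -(m : ℤ) by push_cast; ring, hneg]
    exact hK m

theorem IsSES.comp_equiv {K X M K' M' : Type u} [AddCommGroup K] [Module R K] [AddCommGroup X]
    [Module R X] [AddCommGroup M] [Module R M] [AddCommGroup K'] [Module R K'] [AddCommGroup M']
    [Module R M'] {f : K →ₗ[R] X} {g : X →ₗ[R] M} (h : IsSES f g) (e : K' ≃ₗ[R] K)
    (e' : M ≃ₗ[R] M') : IsSES (f ∘ₗ e.toLinearMap) (e'.toLinearMap ∘ₗ g) := by
  refine ⟨h.inj.comp e.injective, fun x => ?_, e'.surjective.comp h.surj⟩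
  rw [LinearMap.comp_apply, LinearEquiv.coe_coe, e'.map_eq_zero_iff, h.exact x]
  constructor
  · rintro ⟨y, rfl⟩
    exact ⟨e.symm y, by simp⟩
  · rintro ⟨y, rfl⟩
    exact ⟨e y, rfl⟩

theorem Step.congr {𝒳 𝒜 ℬ : ObjectProperty (ModuleCat.{u} R)} {K M K' M' : ModuleCat.{u} R}
    (h : Step 𝒳 𝒜 ℬ K M) (e : K' ≃ₗ[R] K) (e' : M ≃ₗ[R] M') : Step 𝒳 𝒜 ℬ K' M' := by
  obtain ⟨X, f, g, h1, h2, h3, h4⟩ := h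
  refine ⟨X, _, _, h1, h2.comp_equiv e e', fun A hA φ => ?_, fun B hB φ => ?_⟩
  · obtain ⟨ψ, hψ⟩ := h3 A hA (e'.symm.toLinearMap ∘ₗ φ)
    refine ⟨ψ, ?_⟩
    rw [LinearMap.comp_assoc, hψ]
    ext; simp
  · obtain ⟨ψ, hψ⟩ := h4 B hB (φ ∘ₗ e.symm.toLinearMap)
    refine ⟨ψ, ?_⟩
    rw [← LinearMap.comp_assoc, hψ]
    ext; simp

/-- Replaces one term by an isomorphic module, so that later arguments may assume W i = M literally.
-/
theorem steps_update (𝒳 : ℤ → ObjectProperty (ModuleCat.{u} R))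
    (𝒜 ℬ : ObjectProperty (ModuleCat.{u} R)) {W : ℤ → ModuleCat.{u} R}
    (hW : ∀ n, Step (𝒳 n) 𝒜 ℬ (W (n + 1)) (W n)) {i : ℤ} {M : ModuleCat.{u} R}
    (e : M ≅ W i) : ∃ W' : ℤ → ModuleCat.{u} R, W' i = M ∧
      ∀ n, Step (𝒳 n) 𝒜 ℬ (W' (n + 1)) (W' n) := by
  refine ⟨Function.update W i M, by simp, fun n => ?_⟩
  have he : ∀ n, Nonempty (Function.update W i M n ≅ W n) := fun n => by
    by_cases hn : n = i
    · subst hn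
      rw [Function.update_self]
      exact ⟨e⟩
    · rw [Function.update_of_ne hn]
      exact ⟨Iso.refl _⟩
  exact (hW n).congr (he (n + 1)).some.toLinearEquiv (he n).some.toLinearEquiv.symm

theorem gorenstein_iff (𝒳 : ObjectProperty (ModuleCat.{u} R)) (M : ModuleCat.{u} R) :
    gorenstein 𝒳 M ↔
      ∃ W : ℤ → ModuleCat.{u} R, W 0 = M ∧ ∀ n, Step 𝒳 𝒳 𝒳 (W (n + 1)) (W n) := by
  constructor
  · rintro ⟨X, hX, ⟨e⟩⟩
    obtain ⟨W, hW, ⟨e'⟩, -⟩ := exists_steps_of_complex X (fun _ => 𝒳) 𝒳 𝒳 hX.exact hX.mem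
      hX.homFrom_exact hX.homTo_exact
    exact steps_update (fun _ => 𝒳) 𝒳 𝒳 hW (e ≪≫ e'.symm)
  · rintro ⟨W, rfl, hW⟩
    obtain ⟨X, h1, h2, h3, h4, h5, -⟩ := exists_complex_of_steps W (fun _ => 𝒳) 𝒳 𝒳 hW
    exact ⟨X, ⟨h2, h1, h3, h4⟩, h5⟩

theorem gcProjective_iff (C M : ModuleCat.{u} R) :
    gcProjective C M ↔ ∃ W : ℤ → ModuleCat.{u} R, W 0 = M ∧
      (∀ n, 0 ≤ n → Step (fun X => Module.Projective R X) ⊥ (cProjective C) (W (n + 1)) (W n)) ∧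
      (∀ n, n < 0 → Step (cProjective C) ⊥ (cProjective C) (W (n + 1)) (W n)) := by
  -- The class of the n-th term depends on the sign of n; the class ⊥ imposes no lifting condition.
  let 𝒳 : ℤ → ObjectProperty (ModuleCat.{u} R) := fun n X =>
    (0 ≤ n → Module.Projective R X) ∧ (n < 0 → cProjective C X)
  have hbot : ∀ X, (⊥ : ObjectProperty (ModuleCat.{u} R)) X →
    (⊥ : ObjectProperty (ModuleCat.{u} R)) X := fun _ h => h
  constructor
  · rintro ⟨X, hX, ⟨e⟩⟩
    obtain ⟨W, hW, ⟨e'⟩, -⟩ := exists_steps_of_complex X 𝒳 ⊥ (cProjective C) hX.exact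
      (fun n => ⟨hX.projective n, hX.cProjective n⟩) (fun _ h => h.elim) hX.homTo_exact
    obtain ⟨W, h0, hW⟩ := steps_update 𝒳 _ _ hW (e ≪≫ e'.symm)
    exact ⟨W, h0, fun n hn => (hW n).mono (fun X h => h.1 hn) hbot (fun _ h => h),
      fun n hn => (hW n).mono (fun X h => h.2 hn) hbot (fun _ h => h)⟩
  · rintro ⟨W, rfl, hp, hq⟩
    obtain ⟨X, h1, h2, -, h4, h5, -⟩ := exists_complex_of_steps W 𝒳 ⊥ (cProjective C) (fun n => by
      by_cases hn : 0 ≤ n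
      · exact (hp n hn).mono (fun X h => ⟨fun _ => h, fun h' => by omega⟩) hbot (fun _ h => h)
      · exact (hq n (by omega)).mono (fun X h => ⟨fun h' => by omega, fun _ => h⟩) hbot
          (fun _ h => h))
    exact ⟨X, ⟨h1, h4, fun n hn => (h2 n).1 hn, fun n hn => (h2 n).2 hn⟩, h5⟩

theorem gcInjective_iff (C M : ModuleCat.{u} R) :
    gcInjective C M ↔ ∃ W : ℤ → ModuleCat.{u} R, W 1 = M ∧
      (∀ n, n ≤ 0 → Step (fun X => Module.Injective R X) (cInjective C) ⊥ (W (n + 1)) (W n)) ∧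
      (∀ n, 0 < n → Step (cInjective C) (cInjective C) ⊥ (W (n + 1)) (W n)) := by
  let 𝒳 : ℤ → ObjectProperty (ModuleCat.{u} R) := fun n X =>
    (n ≤ 0 → Module.Injective R X) ∧ (0 < n → cInjective C X)
  have hbot : ∀ X, (⊥ : ObjectProperty (ModuleCat.{u} R)) X →
    (⊥ : ObjectProperty (ModuleCat.{u} R)) X := fun _ h => h
  constructor
  · rintro ⟨X, hX, ⟨e⟩⟩
    obtain ⟨W, hW, -, ⟨e'⟩⟩ := exists_steps_of_complex X 𝒳 (cInjective C) ⊥ hX.exact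
      (fun n => ⟨hX.injective n, hX.cInjective n⟩) hX.homFrom_exact (fun _ h => h.elim)
    obtain ⟨W, h0, hW⟩ := steps_update 𝒳 _ _ hW (e ≪≫ e'.symm)
    exact ⟨W, h0, fun n hn => (hW n).mono (fun X h => h.1 hn) (fun _ h => h) hbot,
      fun n hn => (hW n).mono (fun X h => h.2 hn) (fun _ h => h) hbot⟩
  · rintro ⟨W, rfl, hp, hq⟩
    obtain ⟨X, h1, h2, h3, -, -, h5⟩ := exists_complex_of_steps W 𝒳 (cInjective C) ⊥ (fun n => by
      by_cases hn : n ≤ 0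
      · exact (hp n hn).mono (fun X h => ⟨fun _ => h, fun h' => by omega⟩) (fun _ h => h) hbot
      · exact (hq n (by omega)).mono (fun X h => ⟨fun h' => by omega, fun _ => h⟩)
          (fun _ h => h) hbot)
    exact ⟨X, ⟨h1, h3, fun n hn => (h2 n).1 hn, fun n hn => (h2 n).2 hn⟩, h5⟩

/-! ### Vanishing of Tor in terms of Ext into Hom(C, E) -/

theorem exists_syzygies {M : ModuleCat.{u} R} (P : ProjectiveResolution M) :
    ∃ (W : ℕ → ModuleCat.{u} R) (f : ∀ n, W (n + 1) →ₗ[R] P.complex.X n)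
      (g : ∀ n, P.complex.X n →ₗ[R] W n), (∀ n, IsSES (f n) (g n)) ∧
      Nonempty (W 0 ≃ₗ[R] M) ∧ ∀ n, (P.complex.d (n + 1) n).hom = f n ∘ₗ g (n + 1) := by
  let X := P.complex
  have hX : ∀ m : ℕ, Function.Exact (X.d (m + 1 + 1) (m + 1)).hom (X.d (m + 1) m).hom := fun m =>
    (ShortComplex.ShortExact.moduleCat_exact_iff_function_exact _).1 (P.exact_succ m)
  have hle : ∀ m : ℕ, LinearMap.range (X.d (m + 1 + 1) (m + 1)).hom ≤
      LinearMap.ker (X.d (m + 1) m).hom := fun m =>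
    le_of_eq (LinearMap.exact_iff.1 (hX m)).symm
  let W : ℕ → ModuleCat.{u} R := fun n =>
    ModuleCat.of R (X.X n ⧸ LinearMap.range (X.d (n + 1) n).hom)
  let f : ∀ n, W (n + 1) →ₗ[R] X.X n := fun n => Submodule.liftQ _ (X.d (n + 1) n).hom (hle n)
  let g : ∀ n, X.X n →ₗ[R] W n := fun n => Submodule.mkQ _
  have hfg : ∀ n x, f n (g (n + 1) x) = (X.d (n + 1) n).hom x := fun n x => rfl
  have hg : ∀ n, Function.Surjective (g n) := fun n => Submodule.mkQ_surjective _
  have hg0 : ∀ n x, g n x = 0 ↔ ∃ y, (X.d (n + 1) n).hom y = x := fun n x =>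
    (Submodule.Quotient.mk_eq_zero _).trans LinearMap.mem_range
  refine ⟨W, f, g, fun n => ⟨?_, fun x => ?_, hg n⟩, ?_, fun n => rfl⟩
  · rw [injective_iff_map_eq_zero]
    intro w hw
    obtain ⟨x, rfl⟩ := hg _ w
    rw [hfg] at hw
    exact (hg0 _ _).2 ((hX n x).1 hw)
  · rw [hg0]
    constructor
    · rintro ⟨y, rfl⟩
      exact ⟨g (n + 1) y, hfg n y⟩
    · rintro ⟨w, rfl⟩
      obtain ⟨y, rfl⟩ := hg _ w
      exact ⟨y, (hfg n y).symm⟩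
  · have h0 : Function.Exact (X.d 1 0).hom (P.π.f 0).hom :=
      (ShortComplex.ShortExact.moduleCat_exact_iff_function_exact _).1 P.exact₀
    have h1 : Function.Surjective (P.π.f 0).hom :=
      (ModuleCat.epi_iff_surjective (P.π.f 0)).1 inferInstance
    exact ⟨(Submodule.quotEquivOfEq _ _ (LinearMap.exact_iff.1 h0).symm).trans
      (LinearMap.quotKerEquivOfSurjective _ h1)⟩

/-- The differentials factor through the syzygies, and C ⊗ - preserves the surjections and right
exactness. So exactness of C ⊗ P at n + 1 fails exactly by the kernel of C ⊗ f n. -/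
theorem torVanish_iff_injective (C : ModuleCat.{u} R) {M : ModuleCat.{u} R}
    (P : ProjectiveResolution M) {W : ℕ → ModuleCat.{u} R}
    {f : ∀ n, W (n + 1) →ₗ[R] P.complex.X n} {g : ∀ n, P.complex.X n →ₗ[R] W n}
    (hses : ∀ n, IsSES (f n) (g n)) (hd : ∀ n, (P.complex.d (n + 1) n).hom = f n ∘ₗ g (n + 1)) :
    TorVanish C M ↔ ∀ n, Function.Injective (LinearMap.lTensor C (f n)) := by
  have key : ∀ n, IsZero (((Tor (ModuleCat.{u} R) (n + 1)).obj C).obj M) ↔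
      Function.Injective (LinearMap.lTensor C (f n)) := fun n => by
    rw [Tor_obj, (P.isoLeftDerivedObj ((MonoidalCategory.tensoringLeft _).obj C) (n + 1)).isZero_iff]
    have h1 : IsZero ((HomologicalComplex.homologyFunctor _ _ (n + 1)).obj
        ((((MonoidalCategory.tensoringLeft (ModuleCat.{u} R)).obj C).mapHomologicalComplex
          (ComplexShape.down ℕ)).obj P.complex)) ↔
        Function.Exact (LinearMap.lTensor C (P.complex.d (n + 1 + 1) (n + 1)).hom)
          (LinearMap.lTensor C (P.complex.d (n + 1) n).hom) := by
      refine (HomologicalComplex.exactAt_iff_isZero_homology _ _).symm.trans ?_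
      rw [HomologicalComplex.exactAt_iff' _ (n + 1 + 1) (n + 1) n (by simp) (by simp)]
      exact ShortComplex.ShortExact.moduleCat_exact_iff_function_exact _
    rw [h1, hd, hd, LinearMap.lTensor_comp, LinearMap.lTensor_comp]
    have hs : ∀ m, Function.Surjective (LinearMap.lTensor C (g m)) := fun m =>
      LinearMap.lTensor_surjective _ (hses m).surj
    have hex := lTensor_exact C (hses (n + 1)).exact (hses (n + 1)).surj
    rw [injective_iff_map_eq_zero]
    constructor
    · intro h w hw
      obtain ⟨x, rfl⟩ := hs _ w
      obtain ⟨y, rfl⟩ := (h x).1 hw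
      exact hex.apply_apply_eq_zero _
    · intro h x
      constructor
      · intro hx
        obtain ⟨w, rfl⟩ := (hex x).1 (h _ hx)
        obtain ⟨y, rfl⟩ := hs _ w
        exact ⟨y, rfl⟩
      · rintro ⟨y, rfl⟩
        change LinearMap.lTensor C (f n) (LinearMap.lTensor C (g (n + 1))
          (LinearMap.lTensor C (f (n + 1)) _)) = 0
        rw [hex.apply_apply_eq_zero, map_zero]
  constructor
  · exact fun h n => (key n).1 (h (n + 1) (by omega))
  · intro h n hn
    obtain ⟨k, rfl⟩ : ∃ k, n = k + 1 := ⟨n - 1, by omega⟩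
    exact (key k).2 (h k)

section

variable {K X M C B E P : Type u} [AddCommGroup K] [Module R K] [AddCommGroup X] [Module R X]
  [AddCommGroup M] [Module R M] [AddCommGroup C] [Module R C] [AddCommGroup B] [Module R B]
  [AddCommGroup E] [Module R E] [AddCommGroup P] [Module R P]

theorem exists_injective_embedding (M : Type u) [AddCommGroup M] [Module R M] :
    ∃ (E : ModuleCat.{u} R) (i : M →ₗ[R] E), Module.Injective R E ∧ Function.Injective i := by
  have : EnoughInjectives (ModuleCat.{u} R) := ModuleCat.enoughInjectives.{u, u} R
  let I : ModuleCat.{u} R := Injective.under (ModuleCat.of R M)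
  let i : ModuleCat.of R M ⟶ I := Injective.ι (ModuleCat.of R M)
  have hI : Injective (ModuleCat.of R I) := Injective.injective_under (ModuleCat.of R M)
  have hi : Mono i := Injective.ι_mono _
  exact ⟨I, i.hom, Module.injective_module_of_injective_object R I,
    (ModuleCat.mono_iff_injective i).1 hi⟩

/-- An embedding of K into an injective module factors through f. -/
theorem injective_of_forall_extend (f : K →ₗ[R] X)
    (h : ∀ (E : Type u) [AddCommGroup E] [Module R E], Module.Injective R E →
      ∀ φ : K →ₗ[R] E, ∃ ψ : X →ₗ[R] E, ψ ∘ₗ f = φ) : Function.Injective f := by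
  obtain ⟨E, i, hE, hi⟩ := exists_injective_embedding (R := R) K
  obtain ⟨ψ, rfl⟩ := h E hE i
  exact Function.Injective.of_comp (f := ψ) hi

theorem exists_extend_of_injective (hE : Module.Injective R E) {f : K →ₗ[R] X}
    (hf : Function.Injective f) (φ : K →ₗ[R] E) : ∃ ψ : X →ₗ[R] E, ψ ∘ₗ f = φ := by
  obtain ⟨ψ, hψ⟩ := hE.out f hf φ
  exact ⟨ψ, LinearMap.ext hψ⟩

/-- Maps into `Hom(C, E)`, with `E` injective, extend along `f` if `C ⊗ f` is injective. -/
theorem exists_extend_hom (hE : Module.Injective R E) {f : K →ₗ[R] X}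
    (hf : Function.Injective (LinearMap.lTensor C f)) (φ : K →ₗ[R] C →ₗ[R] E) :
    ∃ ψ : X →ₗ[R] C →ₗ[R] E, ψ ∘ₗ f = φ := by
  obtain ⟨ψ, hψ⟩ := exists_extend_of_injective hE hf (TensorProduct.lift φ.flip)
  refine ⟨(TensorProduct.curry ψ).flip, ?_⟩
  ext k c
  simpa using LinearMap.congr_fun hψ (c ⊗ₜ k)

theorem lTensor_injective_of_extend {f : K →ₗ[R] X}
    (h : ∀ (E : Type u) [AddCommGroup E] [Module R E], Module.Injective R E →
      ∀ φ : K →ₗ[R] C →ₗ[R] E, ∃ ψ : X →ₗ[R] C →ₗ[R] E, ψ ∘ₗ f = φ) :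
    Function.Injective (LinearMap.lTensor C f) := by
  refine injective_of_forall_extend _ fun E _ _ hE φ => ?_
  obtain ⟨ψ, hψ⟩ := h E hE (TensorProduct.curry φ).flip
  refine ⟨TensorProduct.lift ψ.flip, ?_⟩
  ext c k
  simpa using LinearMap.congr_fun (LinearMap.congr_fun hψ k) c

end

/-- The derived characterization of `Tor_{≥ 1}(C, M) = 0` by Hom-tensor adjointness. -/
theorem torVanish_iff (C M : ModuleCat.{u} R) : TorVanish C M ↔
    ∀ (E : Type u) [AddCommGroup E] [Module R E], Module.Injective R E →
      ∀ n, ExtZero R (n + 1) M (C →ₗ[R] E) := by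
  obtain ⟨W, f, g, hses, ⟨e⟩, hd⟩ := exists_syzygies (ProjectiveResolution.of M)
  rw [torVanish_iff_injective C _ hses hd]
  have hproj : ∀ n, Module.Projective R ((ProjectiveResolution.of M).complex.X n) := fun n =>
    (IsProjective.iff_projective _).2 ((ProjectiveResolution.of M).projective n)
  constructor
  · intro h E _ _ hE k₀
    have key : ∀ k n, ExtZero R (k + 1) (W n) (C →ₗ[R] E) := by
      intro k
      induction k with
      | zero =>
        intro n
        exact (hses n).ext_one_right (extZero_of_projective 0) (exists_extend_hom hE (h n))
      | succ k ih =>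
        intro n
        exact (hses n).ext_right_of_mid (ih (n + 1)) (extZero_of_projective _)
    exact (key k₀ 0).congr_left e
  · intro h n
    refine lTensor_injective_of_extend fun E _ _ hE φ => ?_
    -- Here the induction is on the syzygy: Ext^{k+1}(W (n+1), -) is governed by Ext^{k+2}(W n, -).
    -- The forward direction inducts on the degree instead.
    have key : ∀ n k, ExtZero R (k + 1) (W n) (C →ₗ[R] E) := by
      intro n
      induction n with
      | zero =>
        intro k
        exact (h E hE k).congr_left e.symm
      | succ n ih =>
        intro k
        exact (hses n).ext_left_of_mid (extZero_of_projective _) (ih (k + 1))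
    exact (hses n).exists_extend (key n 0) φ

/-! ### Tensor evaluation and Hom evaluation for finitely presented modules -/

section

variable {K X F M C B E P I N : Type u} [AddCommGroup K] [Module R K] [AddCommGroup X] [Module R X]
  [AddCommGroup M] [Module R M] [AddCommGroup C] [Module R C] [AddCommGroup B] [Module R B]
  [AddCommGroup E] [Module R E] [AddCommGroup P] [Module R P] [AddCommGroup I] [Module R I]
  [AddCommGroup F] [Module R F] [AddCommGroup N] [Module R N]

theorem exists_dual_basis (F : Type u) [AddCommGroup F] [Module R F] [Module.Finite R F]
    [Module.Projective R F] : ∃ (n : ℕ) (b : Fin n → F) (c : Fin n → F →ₗ[R] R),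
      ∀ x, ∑ i, c i x • b i = x := by
  obtain ⟨n, f, hf⟩ := Module.Finite.exists_fin' R F
  obtain ⟨s, hs⟩ := Module.projective_lifting_property f LinearMap.id hf
  refine ⟨n, fun i => f (Pi.single i 1), fun i => LinearMap.proj i ∘ₗ s, fun x => ?_⟩
  have h1 : f (s x) = x := LinearMap.congr_fun hs x
  conv_rhs => rw [← h1, ← LinearMap.sum_single_apply (φ := fun _ => R) (s x)]
  rw [map_sum]
  refine Finset.sum_congr rfl fun i _ => ?_
  rw [← map_smul]
  congr 1
  ext j
  simp [Pi.single_apply]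

theorem isSES_subtype_ker (g : X →ₗ[R] M) (hg : Function.Surjective g) :
    IsSES (LinearMap.ker g).subtype g :=
  ⟨Subtype.val_injective, LinearMap.exact_subtype_ker_map g, hg⟩

theorem exists_free_cover (K : Type u) [AddCommGroup K] [Module R K]
    [Module.FinitePresentation R K] : ∃ (n : ℕ) (S : Submodule R (Fin n → R))
      (g : (Fin n → R) →ₗ[R] K), IsSES S.subtype g ∧ Module.Finite R S := by
  obtain ⟨n, g, hg⟩ := Module.Finite.exists_fin' R K
  exact ⟨n, LinearMap.ker g, g, isSES_subtype_ker g hg,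
    Module.Finite.iff_fg.2 (Module.FinitePresentation.fg_ker g hg)⟩

theorem IsSES.finitePresentation {f : K →ₗ[R] X} {g : X →ₗ[R] M} (h : IsSES f g)
    [Module.FinitePresentation R X] [Module.Finite R K] : Module.FinitePresentation R M := by
  refine Module.finitePresentation_of_surjective g h.surj ?_
  rw [LinearMap.exact_iff.1 h.exact, ← Submodule.map_top]
  exact Module.Finite.fg_top.map f

variable (R P K C) in
/-- The natural map `P ⊗ Hom(K, C) → Hom(K, P ⊗ C)`. -/
abbrev tensorHom : P ⊗[R] (K →ₗ[R] C) →ₗ[R] K →ₗ[R] P ⊗[R] C :=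
  TensorProduct.lTensorHomToHomLTensor (.id R) K P C

theorem tensorHom_lcomp (g : F →ₗ[R] K) (t : P ⊗[R] (K →ₗ[R] C)) :
    tensorHom R F C P (LinearMap.lTensor P (LinearMap.lcomp R C g) t) = tensorHom R K C P t ∘ₗ g := by
  induction t with
  | zero => simp
  | add x y hx hy => rw [map_add, map_add, hx, hy, map_add, LinearMap.add_comp]
  | tmul p φ => ext; simp

theorem tensorHom_bijective_of_projective [Module.Projective R F] [Module.Finite R F] :
    Function.Bijective (tensorHom R F C P) := by
  have h := (lTensorHomEquivHomLTensor R F P C).bijective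
  have h1 : ⇑(lTensorHomEquivHomLTensor R F P C) = tensorHom R F C P :=
    funext lTensorHomEquivHomLTensor_apply
  rwa [h1] at h

theorem lcomp_injective_of_surjective {g : F →ₗ[R] K} (hg : Function.Surjective g) :
    Function.Injective (LinearMap.lcomp R C g) := fun φ ψ h => by
  ext k
  obtain ⟨x, rfl⟩ := hg k
  exact LinearMap.congr_fun h x

theorem IsSES.lcomp_exact {f : K →ₗ[R] X} {g : X →ₗ[R] M} (h : IsSES f g) :
    Function.Exact (LinearMap.lcomp R C g) (LinearMap.lcomp R C f) := fun φ => by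
  constructor
  · intro hφ
    have h0 : LinearMap.ker g ≤ LinearMap.ker φ := fun x hx => by
      obtain ⟨y, rfl⟩ := (h.exact x).1 hx
      exact LinearMap.congr_fun hφ y
    refine ⟨Submodule.liftQ _ φ h0 ∘ₗ (g.quotKerEquivOfSurjective h.surj).symm.toLinearMap, ?_⟩
    ext x
    have h2 : (g.quotKerEquivOfSurjective h.surj).symm (g x) = Submodule.Quotient.mk x := by
      rw [LinearEquiv.symm_apply_eq]; rfl
    simp [h2]
  · rintro ⟨ψ, rfl⟩
    ext x
    simp [h.exact.apply_apply_eq_zero]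

theorem tensorHom_injective [Module.Flat R P] [Module.Finite R K] :
    Function.Injective (tensorHom R K C P) := by
  obtain ⟨n, g, hg⟩ := Module.Finite.exists_fin' R K
  have h1 : Function.Injective (LinearMap.lTensor P (LinearMap.lcomp R C g)) :=
    Module.Flat.lTensor_preserves_injective_linearMap _ (lcomp_injective_of_surjective hg)
  rw [injective_iff_map_eq_zero]
  intro t ht
  apply h1
  apply (tensorHom_bijective_of_projective (F := Fin n → R)).1
  rw [tensorHom_lcomp, ht, map_zero, map_zero, LinearMap.zero_comp]

/-- Four-lemma argument on 0 → S → Rⁿ → K → 0: the map is bijective for Rⁿ and injective for the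
finite module S, and P ⊗ - keeps the Hom(-, C) sequence exact by flatness. -/
theorem tensorHom_bijective [Module.Flat R P] [Module.FinitePresentation R K] :
    Function.Bijective (tensorHom R K C P) := by
  refine ⟨tensorHom_injective, fun θ => ?_⟩
  obtain ⟨n, S, g, h, hS⟩ := exists_free_cover (R := R) K
  obtain ⟨t, ht⟩ := (tensorHom_bijective_of_projective (C := C) (P := P) (F := Fin n → R)).2
    (θ ∘ₗ g)
  have h1 : LinearMap.lTensor P (LinearMap.lcomp R C S.subtype) t = 0 := by
    apply tensorHom_injective (K := S)
    rw [tensorHom_lcomp, ht, map_zero]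
    ext x
    simpa using congrArg θ (h.exact.apply_apply_eq_zero x)
  obtain ⟨s, hs⟩ := (Module.Flat.lTensor_exact P (h.lcomp_exact (C := C)) t).1 h1
  refine ⟨s, lcomp_injective_of_surjective h.surj ?_⟩
  simp only [LinearMap.lcomp_apply']
  rw [← tensorHom_lcomp, hs, ht]

variable (R K C I) in
/-- The natural map `Hom(C, I) ⊗ K → Hom(Hom(K, C), I)`. -/
def homTensor : (C →ₗ[R] I) ⊗[R] K →ₗ[R] (K →ₗ[R] C) →ₗ[R] I :=
  TensorProduct.lift ((LinearMap.llcomp R (K →ₗ[R] C) C I).flip ∘ₗ LinearMap.applyₗ).flip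

@[simp]
theorem homTensor_tmul (φ : C →ₗ[R] I) (k : K) (ψ : K →ₗ[R] C) :
    homTensor R K C I (φ ⊗ₜ k) ψ = φ (ψ k) := rfl

theorem homTensor_lTensor (g : F →ₗ[R] K) (t : (C →ₗ[R] I) ⊗[R] F) :
    homTensor R K C I (LinearMap.lTensor _ g t) = homTensor R F C I t ∘ₗ LinearMap.lcomp R C g := by
  induction t with
  | zero => simp
  | add x y hx hy => rw [map_add, map_add, hx, hy, map_add, LinearMap.add_comp]
  | tmul p φ => ext; simp

theorem homTensor_bijective_of_projective [Module.Projective R F] [Module.Finite R F] :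
    Function.Bijective (homTensor R F C I) := by
  obtain ⟨n, b, c, hb⟩ := exists_dual_basis (R := R) F
  constructor
  · have key : ∀ t : (C →ₗ[R] I) ⊗[R] F,
        t = ∑ i, (homTensor R F C I t ∘ₗ (LinearMap.smulRightₗ (c i))) ⊗ₜ b i := fun t => by
      induction t with
      | zero => simp
      | add x y hx hy =>
        conv_lhs => rw [hx, hy]
        simp only [map_add, LinearMap.add_comp, TensorProduct.add_tmul, Finset.sum_add_distrib]
      | tmul φ x =>
        conv_lhs => rw [← hb x]
        rw [TensorProduct.tmul_sum]
        refine Finset.sum_congr rfl fun i _ => ?_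
        rw [← TensorProduct.smul_tmul]
        congr 1
        ext y
        simp
    rw [injective_iff_map_eq_zero]
    intro t ht
    rw [key t, ht]
    simp
  · intro ξ
    refine ⟨∑ i, (ξ ∘ₗ (LinearMap.smulRightₗ (c i))) ⊗ₜ b i, ?_⟩
    ext ψ
    rw [map_sum, LinearMap.sum_apply]
    simp only [homTensor_tmul, LinearMap.comp_apply]
    rw [← map_sum]
    congr 1
    ext x
    conv_rhs => rw [← hb x]
    simp

theorem homTensor_surjective (hI : Module.Injective R I) [Module.Finite R K] :
    Function.Surjective (homTensor R K C I) := by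
  obtain ⟨n, g, hg⟩ := Module.Finite.exists_fin' R K
  intro ξ
  obtain ⟨ζ, rfl⟩ := exists_extend_of_injective hI (lcomp_injective_of_surjective (C := C) hg) ξ
  obtain ⟨t, rfl⟩ := (homTensor_bijective_of_projective (F := Fin n → R)).2 ζ
  exact ⟨_, homTensor_lTensor g t⟩

theorem homTensor_bijective (hI : Module.Injective R I) [Module.FinitePresentation R K] :
    Function.Bijective (homTensor R K C I) := by
  refine ⟨?_, homTensor_surjective hI⟩
  rw [injective_iff_map_eq_zero]
  intro t ht
  obtain ⟨n, S, g, h, hS⟩ := exists_free_cover (R := R) K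
  obtain ⟨s, rfl⟩ := LinearMap.lTensor_surjective (C →ₗ[R] I) h.surj t
  rw [homTensor_lTensor] at ht
  let q := LinearMap.lcomp R C S.subtype
  -- The functional attached to s kills the image of Hom(K, C), so it factors through the image of q
  -- in Hom(S, C). It extends to Hom(S, C) since I is injective, and is then represented by r in
  -- Hom(C, I) ⊗ S; hence s comes from S and dies in K.
  have h0 : LinearMap.ker q ≤ LinearMap.ker (homTensor R _ C I s) := fun ψ hψ => by
    obtain ⟨χ, rfl⟩ := (h.lcomp_exact ψ).1 hψ
    exact LinearMap.congr_fun ht χ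
  obtain ⟨ζ, hζ⟩ := exists_extend_of_injective hI
    (f := Submodule.liftQ _ q le_rfl)
    (LinearMap.ker_eq_bot.1 (Submodule.ker_liftQ_eq_bot _ _ _ le_rfl))
    (Submodule.liftQ _ (homTensor R _ C I s) h0)
  obtain ⟨r, hr⟩ := homTensor_surjective hI (K := S) ζ
  have h1 : LinearMap.lTensor _ S.subtype r = s := by
    apply (homTensor_bijective_of_projective (F := Fin n → R)).1
    rw [homTensor_lTensor, hr]
    ext ψ
    exact LinearMap.congr_fun hζ (Submodule.Quotient.mk ψ)
  rw [← h1]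
  exact (lTensor_exact (C →ₗ[R] I) h.exact h.surj).apply_apply_eq_zero r

theorem injective_hom [Module.Flat R F] (hE : Module.Injective R E) :
    Module.Injective R (F →ₗ[R] E) where
  out X Y _ _ _ _ f hf g := by
    obtain ⟨ψ, hψ⟩ := exists_extend_hom hE
      (Module.Flat.lTensor_preserves_injective_linearMap (M := F) f hf) g
    exact ⟨ψ, LinearMap.congr_fun hψ⟩

theorem IsSES.hom_of_extend {f : K →ₗ[R] X} {g : X →ₗ[R] M} (h : IsSES f g)
    (hE : ∀ φ : K →ₗ[R] E, ∃ ψ : X →ₗ[R] E, ψ ∘ₗ f = φ) :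
    IsSES (LinearMap.lcomp R E g) (LinearMap.lcomp R E f) :=
  ⟨lcomp_injective_of_surjective h.surj, h.lcomp_exact, hE⟩

theorem IsSES.hom_of_lift {f : K →ₗ[R] X} {g : X →ₗ[R] M} (h : IsSES f g)
    (hE : ∀ φ : E →ₗ[R] M, ∃ ψ : E →ₗ[R] X, g ∘ₗ ψ = φ) :
    IsSES (LinearMap.compRight R (M := E) f) (LinearMap.compRight R (M := E) g) := by
  refine ⟨fun φ ψ hh => ?_, fun φ => ⟨fun hφ => ?_, ?_⟩, hE⟩
  · ext x
    exact h.inj (LinearMap.congr_fun hh x)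
  · let ι := LinearEquiv.ofInjective f h.inj
    refine ⟨ι.symm.toLinearMap ∘ₗ LinearMap.codRestrict _ φ
      (fun a => (h.exact _).1 (LinearMap.congr_fun hφ a)), ?_⟩
    ext a
    exact congrArg Subtype.val (ι.apply_symm_apply _)
  · rintro ⟨ψ, rfl⟩
    ext a
    exact h.exact.apply_apply_eq_zero _

end

/-! ### Ext against projectives, and the unit and counit of C ⊗ - ⊣ Hom(C, -) -/

section

variable {A K M N P Q : Type u} [AddCommGroup A] [Module R A] [AddCommGroup K] [Module R K]
  [AddCommGroup M] [Module R M] [AddCommGroup N] [Module R N] [AddCommGroup P] [Module R P]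
  [AddCommGroup Q] [Module R Q]

theorem exists_projective_cover (M : Type u) [AddCommGroup M] [Module R M] :
    ∃ (F : ModuleCat.{u} R) (g : F →ₗ[R] M), Module.Projective R F ∧ Function.Surjective g :=
  ⟨ModuleCat.of R (M →₀ R), Finsupp.linearCombination R id,
    inferInstanceAs (Module.Projective R (M →₀ R)), Finsupp.linearCombination_id_surjective R M⟩

/-- In essence Ext(P ⊗ K, N) = Hom(P, Ext(K, N)). In degree one, a map P ⊗ S → N is a map P → Hom(S,
N), lifted along the surjection Hom(F, N) → Hom(S, N). -/
theorem ExtZero.tensor_left [Module.Projective R P] : ∀ {n : ℕ} {K : Type u} [AddCommGroup K]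
    [Module R K], ExtZero R (n + 1) K N → ExtZero R (n + 1) (P ⊗[R] K) N := by
  intro n
  induction n with
  | zero =>
    intro K _ _ h
    obtain ⟨F, g, hF, hg⟩ := exists_projective_cover (R := R) K
    have hses := isSES_subtype_ker g hg
    have hses' : IsSES (LinearMap.lTensor P (LinearMap.ker g).subtype) (LinearMap.lTensor P g) :=
      ⟨Module.Flat.lTensor_preserves_injective_linearMap _ hses.inj,
        lTensor_exact _ hses.exact hses.surj, LinearMap.lTensor_surjective _ hg⟩
    refine hses'.ext_one_right (extZero_of_projective 0) fun φ => ?_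
    obtain ⟨θ, hθ⟩ := Module.projective_lifting_property
      (LinearMap.lcomp R N (LinearMap.ker g).subtype) (TensorProduct.curry φ)
      (fun ψ => hses.exists_extend h ψ)
    refine ⟨TensorProduct.lift θ, ?_⟩
    ext p x
    exact LinearMap.congr_fun (LinearMap.congr_fun hθ p) x
  | succ n ih =>
    intro K _ _ h
    obtain ⟨F, g, hF, hg⟩ := exists_projective_cover (R := R) K
    have hses := isSES_subtype_ker g hg
    have hses' : IsSES (LinearMap.lTensor P (LinearMap.ker g).subtype) (LinearMap.lTensor P g) :=
      ⟨Module.Flat.lTensor_preserves_injective_linearMap _ hses.inj,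
        lTensor_exact _ hses.exact hses.surj, LinearMap.lTensor_surjective _ hg⟩
    exact hses'.ext_right_of_mid (ih (hses.ext_left_of_mid (extZero_of_projective n) h))
      (extZero_of_projective _)

/-- Same argument as for `ExtZero.tensor_left`, reading maps into Hom(Q, M) as maps out of Q. -/
theorem ExtZero.hom_right [Module.Projective R Q] : ∀ {n : ℕ} {N : Type u} [AddCommGroup N]
    [Module R N], ExtZero R (n + 1) N M → ExtZero R (n + 1) N (Q →ₗ[R] M) := by
  intro n
  induction n with
  | zero =>
    intro N _ _ h
    obtain ⟨F, g, hF, hg⟩ := exists_projective_cover (R := R) N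
    have hses := isSES_subtype_ker g hg
    refine hses.ext_one_right (extZero_of_projective 0) fun φ => ?_
    obtain ⟨θ, hθ⟩ := Module.projective_lifting_property
      (LinearMap.lcomp R M (LinearMap.ker g).subtype) φ.flip (fun ψ => hses.exists_extend h ψ)
    refine ⟨θ.flip, ?_⟩
    ext x q
    exact LinearMap.congr_fun (LinearMap.congr_fun hθ q) x
  | succ n ih =>
    intro N _ _ h
    obtain ⟨F, g, hF, hg⟩ := exists_projective_cover (R := R) N
    have hses := isSES_subtype_ker g hg
    exact hses.ext_right_of_mid (ih (hses.ext_left_of_mid (extZero_of_projective n) h))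
      (extZero_of_projective _)

variable (R A M) in
/-- The natural map `M → Hom(A, A ⊗ M)`. -/
abbrev tensorUnit : M →ₗ[R] A →ₗ[R] A ⊗[R] M := (TensorProduct.mk R A M).flip

variable (R A N) in
/-- The evaluation map `A ⊗ Hom(A, N) → N`. -/
abbrev homEval : A ⊗[R] (A →ₗ[R] N) →ₗ[R] N :=
  TensorProduct.lift (LinearMap.applyₗ : A →ₗ[R] (A →ₗ[R] N) →ₗ[R] N)

theorem tensorUnit_naturality (g : M →ₗ[R] N) (m : M) :
    tensorUnit R A N (g m) = LinearMap.lTensor A g ∘ₗ tensorUnit R A M m := by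
  ext a; simp

theorem homEval_naturality (g : M →ₗ[R] N) (t : A ⊗[R] (A →ₗ[R] M)) :
    homEval R A N (LinearMap.lTensor A (LinearMap.compRight R (M := A) g) t) =
      g (homEval R A M t) := by
  induction t with
  | zero => simp
  | add x y hx hy => simp only [map_add, hx, hy]
  | tmul a φ => simp

theorem homEval_lTensor_tensorUnit (t : A ⊗[R] M) :
    homEval R A (A ⊗[R] M) (LinearMap.lTensor A (tensorUnit R A M) t) = t := by
  induction t with
  | zero => simp
  | add x y hx hy => simp only [map_add, hx, hy]
  | tmul a m => simp

theorem homEval_comp_tensorUnit (φ : A →ₗ[R] N) :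
    homEval R A N ∘ₗ tensorUnit R A (A →ₗ[R] N) φ = φ := by
  ext a; simp

/-- Triangle identity: the unit at Hom(A, N) is a one-sided inverse of composition with the
evaluation. -/
theorem tensorUnit_bijective_of_homEval (h : Function.Bijective (homEval R A N)) :
    Function.Bijective (tensorUnit R A (A →ₗ[R] N)) := by
  let e := LinearEquiv.ofBijective _ h
  refine ⟨fun x y hxy => ?_, fun ψ => ⟨homEval R A N ∘ₗ ψ, ?_⟩⟩
  · rw [← homEval_comp_tensorUnit x, hxy, homEval_comp_tensorUnit]
  · ext a
    apply h.1
    exact LinearMap.congr_fun (homEval_comp_tensorUnit (homEval R A N ∘ₗ ψ)) a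

theorem homEval_bijective_of_tensorUnit (h : Function.Bijective (tensorUnit R A M)) :
    Function.Bijective (homEval R A (A ⊗[R] M)) := by
  have h1 : Function.Bijective (LinearMap.lTensor A (tensorUnit R A M)) :=
    (LinearEquiv.lTensor A (LinearEquiv.ofBijective _ h)).bijective
  have h2 : Function.Bijective (homEval R A (A ⊗[R] M) ∘ LinearMap.lTensor A (tensorUnit R A M)) := by
    rw [show homEval R A (A ⊗[R] M) ∘ LinearMap.lTensor A (tensorUnit R A M) = id from
      funext homEval_lTensor_tensorUnit]
    exact Function.bijective_id
  exact (Function.Bijective.of_comp_iff _ h1).1 h2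

theorem homEval_bijective_congr (e : M ≃ₗ[R] N) (h : Function.Bijective (homEval R A M)) :
    Function.Bijective (homEval R A N) := by
  have h1 : Function.Bijective (LinearMap.lTensor A (LinearMap.compRight R (M := A)
      e.toLinearMap)) :=
    (LinearEquiv.lTensor A (e.congrRight : (A →ₗ[R] M) ≃ₗ[R] (A →ₗ[R] N))).bijective
  have h2 : homEval R A N ∘ LinearMap.lTensor A (LinearMap.compRight R (M := A) e.toLinearMap) =
      e ∘ homEval R A M := funext (homEval_naturality e.toLinearMap)
  rw [← Function.Bijective.of_comp_iff _ h1, h2]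
  exact e.bijective.comp h

theorem tensorUnit_bijective_congr (e : M ≃ₗ[R] N) (h : Function.Bijective (tensorUnit R A M)) :
    Function.Bijective (tensorUnit R A N) := by
  let e' : (A →ₗ[R] A ⊗[R] M) ≃ₗ[R] (A →ₗ[R] A ⊗[R] N) := (LinearEquiv.lTensor A e).congrRight
  have h2 : tensorUnit R A N ∘ e = e' ∘ tensorUnit R A M :=
    funext (tensorUnit_naturality e.toLinearMap)
  rw [← Function.Bijective.of_comp_iff _ e.bijective, h2]
  exact e'.bijective.comp h

end

/-! ### Ext vanishing and adjunction isomorphisms for a semidualizing module -/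

namespace IsSemidualizing

variable {C : ModuleCat.{u} R} (hC : IsSemidualizing C)
include hC

theorem exists_syzygies : ∃ (W F : ℕ → ModuleCat.{u} R) (f : ∀ n, W (n + 1) →ₗ[R] F n)
    (g : ∀ n, F n →ₗ[R] W n), (∀ n, IsSES (f n) (g n)) ∧ Nonempty (W 0 ≃ₗ[R] C) ∧
      (∀ n, Module.Projective R (F n)) ∧ (∀ n, Module.Finite R (F n)) ∧
      (∀ n, Module.FinitePresentation R (W n)) ∧ ∀ n k, ExtZero R (k + 1) (W n) C := by
  obtain ⟨P, hP⟩ := hC.exists_resolution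
  obtain ⟨W, f, g, hses, ⟨e⟩, -⟩ := GorensteinCat.exists_syzygies P
  have hfin : ∀ n, Module.Finite R (P.complex.X n) := fun n => (hP n).2
  have hproj : ∀ n, Module.Projective R (P.complex.X n) := fun n => by
    have := (hP n).1
    infer_instance
  have hW : ∀ n, Module.Finite R (W n) := fun n => Module.Finite.of_surjective _ (hses n).surj
  refine ⟨W, P.complex.X, f, g, hses, ⟨e⟩, hproj, hfin, fun n => ?_, fun n => ?_⟩
  · have := Module.finitePresentation_of_projective R (P.complex.X n)
    exact (hses n).finitePresentation
  · induction n with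
    | zero =>
      intro k
      exact ((extVanish_iff C C).1 hC.ext_vanish k).congr_left e.symm
    | succ n ih =>
      intro k
      exact (hses n).ext_left_of_mid (extZero_of_projective k) (ih (k + 1))

theorem finitePresentation : Module.FinitePresentation R C := by
  obtain ⟨W, F, f, g, -, ⟨e⟩, -, -, h, -⟩ := hC.exists_syzygies
  have := h 0
  exact Module.FinitePresentation.of_equiv e

variable {P I E : Type u} [AddCommGroup P] [Module R P] [AddCommGroup I] [Module R I]
  [AddCommGroup E] [Module R E]

/-- Ext¹(W n, C) = 0 makes Hom(F n, C) → Hom(W (n+1), C) surjective. This survives P ⊗ -, and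
`tensorHom` turns it into extension of maps into P ⊗ C. -/
theorem extZero_tensor [Module.Flat R P] (n : ℕ) : ExtZero R (n + 1) C (P ⊗[R] C) := by
  obtain ⟨W, F, f, g, hses, ⟨e⟩, hproj, hfin, hfp, hext⟩ := hC.exists_syzygies
  have key : ∀ k n, ExtZero R (k + 1) (W n) (P ⊗[R] C) := by
    intro k
    induction k with
    | zero =>
      intro n
      refine (hses n).ext_one_right (extZero_of_projective 0) fun φ => ?_
      have := hfp (n + 1)
      obtain ⟨t, rfl⟩ := (tensorHom_bijective (C := C) (P := P) (K := W (n + 1))).2 φ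
      obtain ⟨s, rfl⟩ := LinearMap.lTensor_surjective P (g := LinearMap.lcomp R C (f n))
        ((hses n).exists_extend (hext n 0)) t
      exact ⟨tensorHom R (F n) C P s, (tensorHom_lcomp _ _).symm⟩
    | succ k ih =>
      intro n
      exact (hses n).ext_right_of_mid (ih (n + 1)) (extZero_of_projective _)
  exact (key n 0).congr_left e

/-- Applying Hom(-, E) to the resolution of C coresolves Hom(C, E) by the injectives Hom(F n, E).
The required lifts exist if Hom(C, I) ⊗ f n is injective; via `homTensor` this is Hom(-, I) of the
surjection Hom(F n, C) → Hom(W (n+1), C). -/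
theorem extZero_hom_hom (hI : Module.Injective R I) (hE : Module.Injective R E) (n : ℕ) :
    ExtZero R (n + 1) (C →ₗ[R] I) (C →ₗ[R] E) := by
  obtain ⟨W, F, f, g, hses, ⟨e⟩, hproj, hfin, hfp, hext⟩ := hC.exists_syzygies
  have hses' : ∀ n, IsSES (LinearMap.lcomp R E (g n)) (LinearMap.lcomp R E (f n)) := fun n =>
    (hses n).hom_of_extend (exists_extend_of_injective hE (hses n).inj)
  have hinj : ∀ n, Module.Injective R (F n →ₗ[R] E) := fun n => injective_hom hE
  have key : ∀ k n, ExtZero R (k + 1) (C →ₗ[R] I) (W n →ₗ[R] E) := by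
    intro k
    induction k with
    | zero =>
      intro n
      refine (hses' n).ext_one_left (extZero_of_injective (hinj n) 0) fun φ => ?_
      have h1 : Function.Injective (LinearMap.lTensor (C →ₗ[R] I) (f n)) := by
        rw [injective_iff_map_eq_zero]
        intro t ht
        have := hfp (n + 1)
        apply (homTensor_bijective (C := C) hI (K := W (n + 1))).1
        rw [map_zero]
        ext ψ
        obtain ⟨χ, rfl⟩ := (hses n).exists_extend (hext n 0) ψ
        have h2 := homTensor_lTensor (f n) t
        rw [ht, map_zero] at h2
        exact (LinearMap.congr_fun h2 χ).symm
      obtain ⟨ψ, hψ⟩ := exists_extend_hom hE h1 φ.flip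
      refine ⟨ψ.flip, ?_⟩
      ext a w
      exact LinearMap.congr_fun (LinearMap.congr_fun hψ w) a
    | succ k ih =>
      intro n
      exact (hses' n).ext_to_left_of_mid (ih (n + 1)) (extZero_of_injective (hinj n) _)
  exact (key n 0).congr_right (e.congrLeft E R)

theorem tensorUnit_bijective_of_flat [Module.Flat R P] : Function.Bijective (tensorUnit R C P) := by
  have := hC.finitePresentation
  let e₁ := LinearEquiv.ofBijective _ hC.homothety_bijective
  let e₂ := LinearEquiv.ofBijective _ (tensorHom_bijective (R := R) (P := P) (K := C) (C := C))
  -- P ≅ P ⊗ R ≅ P ⊗ Hom(C, C) ≅ Hom(C, P ⊗ C), by homothety and tensor evaluation.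
  let e : P ≃ₗ[R] (C →ₗ[R] C ⊗[R] P) := (TensorProduct.rid R P).symm ≪≫ₗ
    LinearEquiv.lTensor P e₁ ≪≫ₗ e₂ ≪≫ₗ (TensorProduct.comm R P C).congrRight
  have h : ⇑e = tensorUnit R C P := by
    ext p c
    have h1 : e p = (TensorProduct.comm R P C).toLinearMap ∘ₗ
        tensorHom R C C P (p ⊗ₜ LinearMap.lsmul R C 1) := by
      simp only [e, LinearEquiv.trans_apply, TensorProduct.rid_symm_apply]
      rfl
    rw [h1]
    simp
  rw [← h]
  exact e.bijective

theorem homEval_bijective_of_injective (hI : Module.Injective R I) :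
    Function.Bijective (homEval R C I) := by
  have := hC.finitePresentation
  let e₁ := LinearEquiv.ofBijective _ hC.homothety_bijective
  let e₂ := LinearEquiv.ofBijective _ (homTensor_bijective (C := C) hI (K := C))
  let e : C ⊗[R] (C →ₗ[R] I) ≃ₗ[R] I := TensorProduct.comm R _ _ ≪≫ₗ e₂ ≪≫ₗ
    (e₁.symm.congrLeft I R) ≪≫ₗ LinearMap.ringLmapEquivSelf R R I
  have h : e.toLinearMap = homEval R C I := by
    ext c φ
    have h1 : e (c ⊗ₜ φ) = homTensor R C C I (φ ⊗ₜ c) (LinearMap.lsmul R C 1) := rfl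
    simp [h1]
  have h2 := e.bijective
  rw [← h]
  exact h2

end IsSemidualizing

theorem injective_of_equiv {M N : Type u} [AddCommGroup M] [Module R M] [AddCommGroup N]
    [Module R N] (e : M ≃ₗ[R] N) (h : Module.Injective R M) : Module.Injective R N where
  out X Y _ _ _ _ f hf g := by
    obtain ⟨ψ, hψ⟩ := h.out f hf (e.symm.toLinearMap ∘ₗ g)
    exact ⟨e.toLinearMap ∘ₗ ψ, fun x => by simp [hψ]⟩

theorem IsSES.step {𝒳 𝒜 ℬ : ObjectProperty (ModuleCat.{u} R)} {K X M : ModuleCat.{u} R}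
    {f : K →ₗ[R] X} {g : X →ₗ[R] M} (h : IsSES f g) (hX : 𝒳 X)
    (h𝒜 : ∀ A, 𝒜 A → ExtZero R 1 A K) (hℬ : ∀ B, ℬ B → ExtZero R 1 M B) : Step 𝒳 𝒜 ℬ K M :=
  ⟨X, f, g, hX, h, fun A hA => h.exists_lift (h𝒜 A hA), fun B hB => h.exists_extend (hℬ B hB)⟩

theorem ext_zero_of_steps_left {𝒳 𝒜 ℬ : ObjectProperty (ModuleCat.{u} R)}
    {W : ℤ → ModuleCat.{u} R} {n₀ : ℤ} (hW : ∀ n < n₀, Step 𝒳 𝒜 ℬ (W (n + 1)) (W n))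
    {A : ModuleCat.{u} R} (hA : 𝒜 A) (hX : ∀ X, 𝒳 X → ∀ k, ExtZero R (k + 1) A X) :
    ∀ k, ∀ n ≤ n₀, ExtZero R (k + 1) A (W n) := by
  intro k
  induction k with
  | zero =>
    intro n hn
    obtain ⟨m, rfl⟩ : ∃ m, n = m + 1 := ⟨n - 1, by ring⟩
    obtain ⟨X, f, g, h1, h2, h3, -⟩ := hW m (by omega)
    exact h2.ext_one_left (hX X h1 0) (h3 A hA)
  | succ k ih =>
    intro n hn
    obtain ⟨m, rfl⟩ : ∃ m, n = m + 1 := ⟨n - 1, by ring⟩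
    obtain ⟨X, f, g, h1, h2, -, -⟩ := hW m (by omega)
    exact h2.ext_to_left_of_mid (ih m (by omega)) (hX X h1 _)

theorem ext_zero_of_steps_right {𝒳 𝒜 ℬ : ObjectProperty (ModuleCat.{u} R)}
    {W : ℤ → ModuleCat.{u} R} {n₀ : ℤ} (hW : ∀ n, n₀ ≤ n → Step 𝒳 𝒜 ℬ (W (n + 1)) (W n))
    {B : ModuleCat.{u} R} (hB : ℬ B) (hX : ∀ X, 𝒳 X → ∀ k, ExtZero R (k + 1) X B) :
    ∀ k n, n₀ ≤ n → ExtZero R (k + 1) (W n) B := by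
  intro k
  induction k with
  | zero =>
    intro n hn
    obtain ⟨X, f, g, h1, h2, -, h3⟩ := hW n hn
    exact h2.ext_one_right (hX X h1 0) (h3 B hB)
  | succ k ih =>
    intro n hn
    obtain ⟨X, f, g, h1, h2, -, -⟩ := hW n hn
    exact h2.ext_right_of_mid (ih (n + 1) (by omega)) (hX X h1 _)

/-! ### Foxby equivalence between the Auslander and Bass classes -/

section

variable {C M N : ModuleCat.{u} R}

theorem InBassClass.hom (h : InBassClass C N) :
    InAuslanderClass C (ModuleCat.of R (C →ₗ[R] N)) where
  tor_vanish := h.tor_vanish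
  ext_vanish := (extVanish_iff _ _).2 fun n => ((extVanish_iff _ _).1 h.ext_vanish n).congr_right
    (LinearEquiv.ofBijective _ h.evaluation_bijective).symm
  unit_bijective := tensorUnit_bijective_of_homEval h.evaluation_bijective

theorem InAuslanderClass.tensor (h : InAuslanderClass C M) :
    InBassClass C (ModuleCat.of R (C ⊗[R] M)) where
  ext_vanish := h.ext_vanish
  tor_vanish := (torVanish_iff _ _).2 fun E _ _ hE n =>
    ((torVanish_iff _ _).1 h.tor_vanish E hE n).congr_left
      (LinearEquiv.ofBijective _ h.unit_bijective)
  evaluation_bijective := homEval_bijective_of_tensorUnit h.unit_bijective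

theorem TorVanish.isSES_lTensor {K X : Type u} [AddCommGroup K] [Module R K] [AddCommGroup X]
    [Module R X] (h : TorVanish C M) {f : K →ₗ[R] X} {g : X →ₗ[R] M} (hfg : IsSES f g) :
    IsSES (LinearMap.lTensor C f) (LinearMap.lTensor C g) :=
  ⟨lTensor_injective_of_extend fun E _ _ hE φ =>
    hfg.exists_extend ((torVanish_iff _ _).1 h E hE 0) φ,
    lTensor_exact _ hfg.exact hfg.surj, LinearMap.lTensor_surjective _ hfg.surj⟩

end

/-! ### Membership of chains in the two classes, and single resolution steps -/

namespace IsSemidualizing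

variable {C : ModuleCat.{u} R} (hC : IsSemidualizing C)
include hC

theorem extZero_cProjective {X Y : ModuleCat.{u} R} (hX : cProjective C X) (hY : cProjective C Y)
    (n : ℕ) : ExtZero R (n + 1) X Y := by
  obtain ⟨P, hP, ⟨e⟩⟩ := hX
  obtain ⟨Q, hQ, ⟨e'⟩⟩ := hY
  exact ((hC.extZero_tensor (P := Q) n).tensor_left (P := P)).congr_left e.toLinearEquiv.symm
    |>.congr_right e'.toLinearEquiv.symm

theorem extZero_cInjective {X Y : ModuleCat.{u} R} (hX : cInjective C X) (hY : cInjective C Y)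
    (n : ℕ) : ExtZero R (n + 1) X Y := by
  obtain ⟨P, hP, ⟨e⟩⟩ := hX
  obtain ⟨Q, hQ, ⟨e'⟩⟩ := hY
  exact ((hC.extZero_hom_hom hP hQ n).congr_left e.toLinearEquiv.symm).congr_right
    e'.toLinearEquiv.symm

omit hC in
theorem cProjective_tensor (P : ModuleCat.{u} R) (hP : Module.Projective R P) :
    cProjective C (ModuleCat.of R (C ⊗[R] P)) :=
  ⟨P, hP, ⟨(TensorProduct.comm R C P).toModuleIso⟩⟩

omit hC in
theorem cProjective_self : cProjective C C :=
  ⟨ModuleCat.of R R, inferInstanceAs (Module.Projective R R),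
    ⟨(TensorProduct.lid R C).symm.toModuleIso⟩⟩

theorem homEval_bijective_of_cProjective {X : ModuleCat.{u} R} (hX : cProjective C X) :
    Function.Bijective (homEval R C X) := by
  obtain ⟨P, hP, ⟨e⟩⟩ := hX
  exact homEval_bijective_congr (TensorProduct.comm R C P ≪≫ₗ e.toLinearEquiv.symm)
    (homEval_bijective_of_tensorUnit hC.tensorUnit_bijective_of_flat)

theorem projective_hom_of_cProjective {X : ModuleCat.{u} R} (hX : cProjective C X) :
    Module.Projective R (C →ₗ[R] X) := by
  obtain ⟨P, hP, ⟨e⟩⟩ := hX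
  exact Module.Projective.of_equiv' ((LinearEquiv.ofBijective _
    (hC.tensorUnit_bijective_of_flat (P := P))) ≪≫ₗ
    (TensorProduct.comm R C P ≪≫ₗ e.toLinearEquiv.symm).congrRight)

theorem tensorUnit_bijective_of_cInjective {X : ModuleCat.{u} R} (hX : cInjective C X) :
    Function.Bijective (tensorUnit R C X) := by
  obtain ⟨I, hI, ⟨e⟩⟩ := hX
  exact tensorUnit_bijective_congr e.toLinearEquiv.symm
    (tensorUnit_bijective_of_homEval (hC.homEval_bijective_of_injective hI))

theorem injective_tensor_of_cInjective {X : ModuleCat.{u} R} (hX : cInjective C X) :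
    Module.Injective R (C ⊗[R] X) := by
  obtain ⟨I, hI, ⟨e⟩⟩ := hX
  exact injective_of_equiv ((LinearEquiv.ofBijective _
    (hC.homEval_bijective_of_injective hI)).symm ≪≫ₗ
    LinearEquiv.lTensor C e.toLinearEquiv.symm) hI

/-- Only lifting of maps from C is needed, so the finitely generated case is covered too. Evaluation
at W n is onto because it is at X n; surjectivity at W (n+1) then gives injectivity at W n. -/
theorem bassClass_of_steps {𝒳 𝒜 ℬ : ObjectProperty (ModuleCat.{u} R)} {W : ℤ → ModuleCat.{u} R}
    (hW : ∀ n, Step 𝒳 𝒜 ℬ (W (n + 1)) (W n)) (h𝒳 : ∀ X, 𝒳 X → cProjective C X) (h𝒜 : 𝒜 C)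
    (n : ℤ) : InBassClass C (W n) := by
  have hext : ∀ k, ExtZero R (k + 1) C (W n) := fun k =>
    ext_zero_of_steps_left (n₀ := n) (fun n _ => hW n) h𝒜
      (fun X hX k => hC.extZero_cProjective cProjective_self (h𝒳 X hX) k) k n le_rfl
  choose X f g hX hses hlift hextend using hW
  have hev : ∀ n, Function.Bijective (homEval R C (X n)) := fun n =>
    hC.homEval_bijective_of_cProjective (h𝒳 _ (hX n))
  have hses' := fun n => (hses n).hom_of_lift (hlift n C h𝒜)
  have hsurj : ∀ n, Function.Surjective (homEval R C (W n)) := fun n w => by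
    obtain ⟨x, rfl⟩ := (hses n).surj w
    obtain ⟨t, rfl⟩ := (hev n).2 x
    exact ⟨_, homEval_naturality (g n) t⟩
  have hinj : ∀ n, Function.Injective (homEval R C (W n)) := fun n => by
    rw [injective_iff_map_eq_zero]
    intro t ht
    obtain ⟨s, rfl⟩ := LinearMap.lTensor_surjective C (hses' n).surj t
    rw [homEval_naturality] at ht
    obtain ⟨y, hy⟩ := ((hses n).exact _).1 ht
    obtain ⟨r, rfl⟩ := hsurj _ y
    rw [← homEval_naturality] at hy
    rw [← (hev n).1 hy]
    exact (lTensor_exact C (hses' n).exact (hses' n).surj).apply_apply_eq_zero r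
  refine ⟨(extVanish_iff _ _).2 hext, (torVanish_iff _ _).2 fun E _ _ hE k => ?_,
    hinj n, hsurj n⟩
  have hproj := fun n => hC.projective_hom_of_cProjective (h𝒳 _ (hX n))
  have htensor : ∀ n, Function.Injective
      (LinearMap.lTensor C (LinearMap.compRight R (M := C) (f n))) := fun n s t hst => by
    apply hinj (n + 1)
    apply (hses n).inj
    rw [← homEval_naturality, hst, homEval_naturality]
  have key : ∀ k n, ExtZero R (k + 1) (C →ₗ[R] W n) (C →ₗ[R] E) := by
    intro k
    induction k with
    | zero =>
      intro n
      exact (hses' n).ext_one_right (extZero_of_projective 0) (exists_extend_hom hE (htensor n))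
    | succ k ih =>
      intro n
      exact (hses' n).ext_right_of_mid (ih (n + 1)) (extZero_of_projective _)
  exact key k n

theorem auslanderClass_of_steps {𝒜 : ObjectProperty (ModuleCat.{u} R)} {W : ℤ → ModuleCat.{u} R}
    (hW : ∀ n, Step (cInjective C) 𝒜 (cInjective C) (W (n + 1)) (W n)) (n : ℤ) :
    InAuslanderClass C (W n) := by
  have htor : ∀ n, TorVanish C (W n) := fun n => (torVanish_iff _ _).2 fun E _ _ hE k =>
    ext_zero_of_steps_right (n₀ := n) (fun n _ => hW n)
      (B := ModuleCat.of R (C →ₗ[R] E)) ⟨ModuleCat.of R E, hE, ⟨Iso.refl _⟩⟩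
      (fun X hX k => hC.extZero_cInjective hX ⟨ModuleCat.of R E, hE, ⟨Iso.refl _⟩⟩ k) k n le_rfl
  choose X f g hX hses hlift hextend using hW
  have hunit : ∀ n, Function.Bijective (tensorUnit R C (X n)) := fun n =>
    hC.tensorUnit_bijective_of_cInjective (hX n)
  have hses' := fun n => (htor n).isSES_lTensor (hses n)
  have hinjX := fun n => hC.injective_tensor_of_cInjective (hX n)
  have hinj : ∀ n, Function.Injective (tensorUnit R C (W (n + 1))) := fun n => by
    rw [injective_iff_map_eq_zero]
    intro w hw
    apply (hses n).inj
    apply (hunit n).1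
    rw [tensorUnit_naturality, hw, map_zero, map_zero, LinearMap.comp_zero]
  -- Surjectivity at a kernel uses injectivity at the next cokernel W (n+1), which in turn uses its
  -- embedding in X n; hence the double shift.
  have hsurj : ∀ n, Function.Surjective (tensorUnit R C (W (n + 1 + 1))) := fun n φ => by
    obtain ⟨x, hx⟩ := (hunit (n + 1)).2 (LinearMap.lTensor C (f (n + 1)) ∘ₗ φ)
    have h1 : g (n + 1) x = 0 := by
      apply hinj n
      rw [tensorUnit_naturality, hx, map_zero]
      ext c
      exact (hses' (n + 1)).exact.apply_apply_eq_zero (φ c)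
    obtain ⟨w, rfl⟩ := ((hses (n + 1)).exact x).1 h1
    refine ⟨w, ?_⟩
    rw [tensorUnit_naturality] at hx
    ext c
    exact (hses' (n + 1)).inj (LinearMap.congr_fun hx c)
  have hbij : ∀ n, Function.Bijective (tensorUnit R C (W n)) := fun n => by
    obtain ⟨m, rfl⟩ : ∃ m, n = m + 1 + 1 := ⟨n - 1 - 1, by ring⟩
    exact ⟨hinj (m + 1), hsurj m⟩
  refine ⟨htor n, (extVanish_iff _ _).2 fun k => ?_, hbij n⟩
  have key : ∀ k n, ExtZero R (k + 1) C (C ⊗[R] W (n + 1)) := by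
    intro k
    induction k with
    | zero =>
      intro n
      refine (hses' n).ext_one_left (extZero_of_injective (hinjX n) 0) fun φ => ?_
      obtain ⟨w, rfl⟩ := (hbij n).2 φ
      obtain ⟨x, rfl⟩ := (hses n).surj w
      exact ⟨tensorUnit R C (X n) x, (tensorUnit_naturality _ _).symm⟩
    | succ k ih =>
      intro n
      refine (hses' n).ext_to_left_of_mid ?_ (extZero_of_injective (hinjX n) _)
      obtain ⟨m, rfl⟩ : ∃ m, n = m + 1 := ⟨n - 1, by ring⟩
      exact ih m
  obtain ⟨m, rfl⟩ : ∃ m, n = m + 1 := ⟨n - 1, by ring⟩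
  exact key k m

/-- Covering a module of the Auslander class by a projective module and tensoring with `C`. -/
theorem auslanderClass_step {A N F : ModuleCat.{u} R} (hA : InAuslanderClass C A)
    (e : C ⊗[R] A ≃ₗ[R] N) (hF : Module.Projective R F) (g : F →ₗ[R] A)
    (hg : Function.Surjective g) {𝒳 𝒬 : ObjectProperty (ModuleCat.{u} R)}
    (h𝒳 : 𝒳 (ModuleCat.of R (C ⊗[R] F))) (h𝒬 : ∀ Q, 𝒬 Q → cProjective C Q)
    (hN : ∀ Q, 𝒬 Q → ∀ k, ExtZero R (k + 1) N Q) :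
    InAuslanderClass C (ModuleCat.of R (LinearMap.ker g)) ∧
      (∀ Q, 𝒬 Q → ∀ k, ExtZero R (k + 1) (C ⊗[R] LinearMap.ker g) Q) ∧
      Step 𝒳 (cProjective C) 𝒬 (ModuleCat.of R (C ⊗[R] LinearMap.ker g)) N := by
  have hses := isSES_subtype_ker g hg
  have hses' := hA.tor_vanish.isSES_lTensor hses
  have htor := (torVanish_iff _ _).1 hA.tor_vanish
  have hext := (extVanish_iff _ _).1 hA.ext_vanish
  have hCF : ∀ k, ExtZero R (k + 1) C (C ⊗[R] F) := fun k =>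
    (hC.extZero_tensor (P := F) k).congr_right (TensorProduct.comm R F C)
  have hunit := hC.tensorUnit_bijective_of_flat (P := F)
  -- In degree one, every map C → C ⊗ A comes from an element of A, and elements of A lift to F.
  have hCK : ∀ k, ExtZero R (k + 1) C (C ⊗[R] LinearMap.ker g) := by
    rintro (_ | k)
    · refine hses'.ext_one_left (hCF 0) fun φ => ?_
      obtain ⟨a, rfl⟩ := hA.unit_bijective.2 φ
      obtain ⟨x, rfl⟩ := hg a
      exact ⟨tensorUnit R C F x, (tensorUnit_naturality _ _).symm⟩
    · exact hses'.ext_to_left_of_mid (hext k) (hCF _)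
  refine ⟨⟨(torVanish_iff _ _).2 fun E _ _ hE k => ?_, (extVanish_iff _ _).2 hCK, ?_⟩,
    fun Q hQ k => ?_, ?_⟩
  · exact hses.ext_left_of_mid (extZero_of_projective k) (htor E hE (k + 1))
  · constructor
    · refine (injective_iff_map_eq_zero (tensorUnit R C (LinearMap.ker g))).2 fun x hx => ?_
      apply hses.inj
      apply hunit.1
      rw [tensorUnit_naturality, hx, map_zero, map_zero, LinearMap.comp_zero]
    · intro φ
      obtain ⟨y, hy⟩ := hunit.2 (LinearMap.lTensor C (LinearMap.ker g).subtype ∘ₗ φ)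
      have h1 : g y = 0 := by
        apply hA.unit_bijective.1
        change tensorUnit R C A (g y) = tensorUnit R C A 0
        rw [tensorUnit_naturality, hy, map_zero]
        ext c
        exact hses'.exact.apply_apply_eq_zero (φ c)
      refine ⟨⟨y, h1⟩, ?_⟩
      ext c
      apply hses'.inj
      exact (LinearMap.congr_fun (tensorUnit_naturality (A := C) (LinearMap.ker g).subtype
        ⟨y, h1⟩) c).symm.trans (LinearMap.congr_fun hy c)
  · refine hses'.ext_left_of_mid ?_ ((hN Q hQ (k + 1)).congr_left e.symm)
    exact hC.extZero_cProjective (cProjective_tensor F hF) (h𝒬 Q hQ) k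
  · have h1 := hses'.comp_equiv (LinearEquiv.refl R _) e
    refine h1.step (K := ModuleCat.of R (C ⊗[R] LinearMap.ker g))
      (X := ModuleCat.of R (C ⊗[R] F)) h𝒳 (fun P hP => ?_) fun Q hQ => hN Q hQ 0
    obtain ⟨P, hP, ⟨e⟩⟩ := hP
    exact ((hCK 0).tensor_left (P := P)).congr_left e.toLinearEquiv.symm

/-- Embedding a module of the Bass class into an injective module and applying `Hom(C, -)`. -/
theorem bassClass_step {B N I : ModuleCat.{u} R} (hB : InBassClass C B)
    (e : N ≃ₗ[R] (C →ₗ[R] B)) (hI : Module.Injective R I) (i : B →ₗ[R] I)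
    (hi : Function.Injective i) (hN : ∀ J, cInjective C J → ∀ k, ExtZero R (k + 1) J N) :
    InBassClass C (ModuleCat.of R (I ⧸ LinearMap.range i)) ∧
      (∀ J, cInjective C J → ∀ k, ExtZero R (k + 1) J (C →ₗ[R] I ⧸ LinearMap.range i)) ∧
      Step (cInjective C) (cInjective C) (cInjective C) N
        (ModuleCat.of R (C →ₗ[R] I ⧸ LinearMap.range i)) := by
  have hses : IsSES i (LinearMap.range i).mkQ :=
    ⟨hi, LinearMap.exact_map_mkQ_range i, Submodule.mkQ_surjective _⟩
  have hext := (extVanish_iff _ _).1 hB.ext_vanish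
  have htor := (torVanish_iff _ _).1 hB.tor_vanish
  have hses' := hses.hom_of_lift (hses.exists_lift (hext 0))
  have hevI := hC.homEval_bijective_of_injective hI
  have hcI : cInjective C (ModuleCat.of R (C →ₗ[R] I)) := ⟨I, hI, ⟨Iso.refl _⟩⟩
  have hcE : ∀ (E : Type u) [AddCommGroup E] [Module R E], Module.Injective R E →
      cInjective C (ModuleCat.of R (C →ₗ[R] E)) := fun E _ _ hE =>
    ⟨ModuleCat.of R E, hE, ⟨Iso.refl _⟩⟩
  -- Followed by evaluation at I, this map equals evaluation at B followed by i, a composite of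
  -- injections.
  have htensor : Function.Injective (LinearMap.lTensor C (LinearMap.compRight R (M := C) i)) :=
    fun s t hst => by
      apply hB.evaluation_bijective.1
      apply hi
      have h1 := homEval_naturality (A := C) i s
      rw [hst, homEval_naturality] at h1
      exact h1.symm
  have hT : ∀ (E : Type u) [AddCommGroup E] [Module R E], Module.Injective R E → ∀ k,
      ExtZero R (k + 1) (C →ₗ[R] I ⧸ LinearMap.range i) (C →ₗ[R] E) := by
    rintro E _ _ hE (_ | k)
    · exact hses'.ext_one_right (hC.extZero_hom_hom hI hE 0) (exists_extend_hom hE htensor)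
    · exact hses'.ext_right_of_mid (htor E hE k) (hC.extZero_hom_hom hI hE _)
  refine ⟨⟨(extVanish_iff _ _).2 fun k => ?_, (torVanish_iff _ _).2 hT, ?_, ?_⟩,
    fun J hJ k => ?_, ?_⟩
  · exact hses.ext_to_right_of_mid (extZero_of_injective hI k) (hext (k + 1))
  · refine (injective_iff_map_eq_zero (homEval R C (I ⧸ LinearMap.range i))).2 fun t ht => ?_
    obtain ⟨s, rfl⟩ := LinearMap.lTensor_surjective C hses'.surj t
    rw [homEval_naturality] at ht
    obtain ⟨b, hb⟩ := (hses.exact _).1 ht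
    obtain ⟨r, rfl⟩ := hB.evaluation_bijective.2 b
    have h1 := homEval_naturality (A := C) i r
    rw [← hevI.1 (h1.trans hb)]
    exact (lTensor_exact C hses'.exact hses'.surj).apply_apply_eq_zero r
  · intro l
    obtain ⟨x, rfl⟩ := hses.surj l
    obtain ⟨t, rfl⟩ := hevI.2 x
    exact ⟨_, homEval_naturality _ t⟩
  · exact hses'.ext_to_right_of_mid (hC.extZero_cInjective hJ hcI k)
      ((hN J hJ (k + 1)).congr_right e)
  · have h1 := hses'.comp_equiv e (LinearEquiv.refl R _)
    refine h1.step (X := ModuleCat.of R (C →ₗ[R] I))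
      (M := ModuleCat.of R (C →ₗ[R] I ⧸ LinearMap.range i)) hcI (fun J hJ => hN J hJ 0) ?_
    rintro B ⟨E, hE, ⟨e'⟩⟩
    exact (hT E hE 0).congr_right e'.toLinearEquiv.symm

end IsSemidualizing

/-! ### The equalities for C-projective and C-injective modules -/

namespace IsSemidualizing

variable {C : ModuleCat.{u} R} (hC : IsSemidualizing C)
include hC

theorem gorenstein_cProjective :
    gorenstein (cProjective C) = gcProjective C ⊓ bassClass C := by
  ext M
  constructor
  · intro hM
    obtain ⟨W, rfl, hW⟩ := (gorenstein_iff _ _).1 hM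
    refine ⟨?_, hC.bassClass_of_steps hW (fun _ h => h) cProjective_self 0⟩
    let S : ModuleCat.{u} R → Prop := fun N =>
      ∀ Q, cProjective C Q → ∀ k, ExtZero R (k + 1) N Q
    have hS : S (W 0) := fun Q hQ k =>
      ext_zero_of_steps_right (n₀ := 0) (fun n _ => hW n) hQ
        (fun X hX k => hC.extZero_cProjective hX hQ k) k 0 le_rfl
    obtain ⟨L, hL0, hL⟩ := exists_seq_of_forall S
      (fun N K => Step (fun X => Module.Projective R X) ⊥ (cProjective C) K N) (fun N hN => by
        obtain ⟨F, g, hF, hg⟩ := exists_projective_cover (R := R) N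
        have hses := isSES_subtype_ker g hg
        refine ⟨ModuleCat.of R (LinearMap.ker g), fun Q hQ k =>
          hses.ext_left_of_mid (extZero_of_projective k) (hN Q hQ (k + 1)), ?_⟩
        exact hses.step (K := ModuleCat.of R (LinearMap.ker g)) hF (fun _ h => h.elim)
          (fun Q hQ => hN Q hQ 0)) (W 0) hS
    -- New left half of projectives, old right half of C-projectives, glued at W 0.
    obtain ⟨V, hV0, hV⟩ := exists_int_seq
      (p := Step (fun X => Module.Projective R X) ⊥ (cProjective C))
      (q := Step (cProjective C) ⊥ (cProjective C)) L (fun n : ℕ => W (-n)) (by simpa using hL0)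
      hL (fun n => by
        have h := hW (-((n + 1 : ℕ) : ℤ))
        rw [show -((n + 1 : ℕ) : ℤ) + 1 = -(n : ℤ) by push_cast; ring] at h
        exact h.mono (fun _ h => h) (fun _ h => h.elim) (fun _ h => h))
    exact (gcProjective_iff _ _).2 ⟨V, hV0.trans hL0, hV⟩
  · rintro ⟨hM, hB⟩
    obtain ⟨W, rfl, hp, hq⟩ := (gcProjective_iff _ _).1 hM
    have hB : InBassClass C (W 0) := hB
    have hext : ∀ Q, cProjective C Q → ∀ k, ExtZero R (k + 1) (W 0) Q := fun Q hQ k =>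
      ext_zero_of_steps_right (n₀ := 0) hp hQ (fun X hX k => by
        have : Module.Projective R X := hX
        exact extZero_of_projective k) k 0 le_rfl
    -- The invariant remembers N as C ⊗ A, so that a projective cover of A yields the next
    -- C-projective term.
    let S : ModuleCat.{u} R → Prop := fun N => ∃ A : ModuleCat.{u} R, InAuslanderClass C A ∧
      Nonempty (C ⊗[R] A ≃ₗ[R] N) ∧ ∀ Q, cProjective C Q → ∀ k, ExtZero R (k + 1) N Q
    have hS : S (W 0) := ⟨_, hB.hom, ⟨LinearEquiv.ofBijective _ hB.evaluation_bijective⟩, hext⟩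
    obtain ⟨L, hL0, hL⟩ := exists_seq_of_forall S
      (fun N K => Step (cProjective C) (cProjective C) (cProjective C) K N) (fun N hN => by
        obtain ⟨A, hA, ⟨e⟩, hQ⟩ := hN
        obtain ⟨F, g, hF, hg⟩ := exists_projective_cover (R := R) A
        obtain ⟨h1, h2, h3⟩ := hC.auslanderClass_step hA e hF g hg (cProjective_tensor F hF)
          (fun _ h => h) hQ
        exact ⟨_, ⟨_, h1, ⟨LinearEquiv.refl R _⟩, h2⟩, h3⟩) (W 0) hS
    -- The missing Hom(C, -)-exactness of the right half: vanishing at W 0 passes to cosyzygies.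
    have hCW : ∀ n : ℕ, ∀ k, ExtZero R (k + 1) C (W (-n)) := by
      intro n
      induction n with
      | zero => exact (extVanish_iff _ _).1 hB.ext_vanish
      | succ n ih =>
        intro k
        have h := hq (-((n + 1 : ℕ) : ℤ)) (by omega)
        rw [show -((n + 1 : ℕ) : ℤ) + 1 = -(n : ℤ) by push_cast; ring] at h
        obtain ⟨X, f, g, hX, hses, -, -⟩ := h
        exact hses.ext_to_right_of_mid (hC.extZero_cProjective cProjective_self hX k) (ih (k + 1))
    obtain ⟨V, hV0, hVp, hVq⟩ := exists_int_seq
      (p := Step (cProjective C) (cProjective C) (cProjective C))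
      (q := Step (cProjective C) (cProjective C) (cProjective C)) L (fun n : ℕ => W (-n))
      (by simpa using hL0) hL (fun n => by
        have h := hq (-((n + 1 : ℕ) : ℤ)) (by omega)
        rw [show -((n + 1 : ℕ) : ℤ) + 1 = -(n : ℤ) by push_cast; ring] at h
        obtain ⟨X, f, g, hX, hses, -, h2⟩ := h
        refine ⟨X, f, g, hX, hses, fun A hA => hses.exists_lift ?_, h2⟩
        obtain ⟨P, hP, ⟨e⟩⟩ := hA
        exact ((hCW n 0).tensor_left (P := P)).congr_left e.toLinearEquiv.symm)
    exact (gorenstein_iff _ _).2 ⟨V, hV0.trans hL0, fun n =>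
      (lt_or_ge n 0).elim (hVq n) (hVp n)⟩

theorem gorenstein_cInjective :
    gorenstein (cInjective C) = gcInjective C ⊓ auslanderClass C := by
  ext M
  constructor
  · intro hM
    obtain ⟨W, rfl, hW⟩ := (gorenstein_iff _ _).1 hM
    refine ⟨?_, hC.auslanderClass_of_steps hW 0⟩
    let S : ModuleCat.{u} R → Prop := fun N =>
      ∀ J, cInjective C J → ∀ k, ExtZero R (k + 1) J N
    have hS : S (W 0) := fun J hJ k =>
      ext_zero_of_steps_left (n₀ := 0) (fun n _ => hW n) hJ
        (fun X hX k => hC.extZero_cInjective hJ hX k) k 0 le_rfl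
    obtain ⟨L, hL0, hL⟩ := exists_seq_of_forall S
      (fun N K => Step (fun X => Module.Injective R X) (cInjective C) ⊥ N K) (fun N hN => by
        obtain ⟨I, i, hI, hi⟩ := exists_injective_embedding (R := R) N
        have hses : IsSES i (LinearMap.range i).mkQ :=
          ⟨hi, LinearMap.exact_map_mkQ_range i, Submodule.mkQ_surjective _⟩
        refine ⟨ModuleCat.of R (I ⧸ LinearMap.range i), fun J hJ k =>
          hses.ext_to_right_of_mid (extZero_of_injective hI k) (hN J hJ (k + 1)), ?_⟩
        exact hses.step (M := ModuleCat.of R (I ⧸ LinearMap.range i)) hI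
          (fun J hJ => hN J hJ 0) (fun _ h => h.elim)) (W 0) hS
    obtain ⟨V, hV0, hVp, hVq⟩ := exists_int_seq
      (p := Step (cInjective C) (cInjective C) ⊥)
      (q := Step (fun X => Module.Injective R X) (cInjective C) ⊥) (fun n : ℕ => W n) L
      (by simpa using hL0.symm)
      (fun n => by
        have h := hW n
        push_cast
        exact h.mono (fun _ h => h) (fun _ h => h) (fun _ h => h.elim)) hL
    -- The gluing is at index 0, whereas a G_C-injective module sits at index 1.
    refine (gcInjective_iff _ _).2 ⟨fun n => V (n - 1), by simpa using hV0, fun n hn => ?_,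
      fun n hn => ?_⟩
    · have h := hVq (n - 1) (by omega)
      rwa [show n - 1 + 1 = n + 1 - 1 by ring] at h
    · have h := hVp (n - 1) (by omega)
      rwa [show n - 1 + 1 = n + 1 - 1 by ring] at h
  · rintro ⟨hM, hA⟩
    obtain ⟨W, rfl, hp, hq⟩ := (gcInjective_iff _ _).1 hM
    have hA : InAuslanderClass C (W 1) := hA
    have hext : ∀ J, cInjective C J → ∀ k, ExtZero R (k + 1) J (W 1) := fun J hJ k =>
      ext_zero_of_steps_left (n₀ := 1) (fun n hn => hp n (by omega)) hJ
        (fun X hX k => extZero_of_injective hX k) k 1 le_rfl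
    let S : ModuleCat.{u} R → Prop := fun N => ∃ B : ModuleCat.{u} R, InBassClass C B ∧
      Nonempty (N ≃ₗ[R] (C →ₗ[R] B)) ∧ ∀ J, cInjective C J → ∀ k, ExtZero R (k + 1) J N
    have hS : S (W 1) := ⟨_, hA.tensor, ⟨LinearEquiv.ofBijective _ hA.unit_bijective⟩, hext⟩
    obtain ⟨L, hL0, hL⟩ := exists_seq_of_forall S
      (fun N K => Step (cInjective C) (cInjective C) (cInjective C) N K) (fun N hN => by
        obtain ⟨B, hB, ⟨e⟩, hJ⟩ := hN
        obtain ⟨I, i, hI, hi⟩ := exists_injective_embedding (R := R) B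
        obtain ⟨h1, h2, h3⟩ := hC.bassClass_step hB e hI i hi hJ
        exact ⟨_, ⟨_, h1, ⟨LinearEquiv.refl R _⟩, h2⟩, h3⟩) (W 1) hS
    -- Tor^{≥1}(C, W 1) = 0 is Ext vanishing into C-injectives; it passes to syzygies and gives the
    -- extension property on the left half.
    have hWJ : ∀ n : ℕ, ∀ J, cInjective C J → ∀ k, ExtZero R (k + 1) (W (n + 1)) J := by
      intro n
      induction n with
      | zero =>
        rintro J ⟨E, hE, ⟨e⟩⟩ k
        exact ((torVanish_iff _ _).1 hA.tor_vanish E hE k).congr_right e.toLinearEquiv.symm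
      | succ n ih =>
        intro J hJ k
        obtain ⟨X, f, g, hX, hses, -, -⟩ := hq (n + 1) (by omega)
        push_cast
        exact hses.ext_left_of_mid (hC.extZero_cInjective hX hJ k) (ih J hJ (k + 1))
    obtain ⟨V, hV0, hVp, hVq⟩ := exists_int_seq
      (p := Step (cInjective C) (cInjective C) (cInjective C))
      (q := Step (cInjective C) (cInjective C) (cInjective C)) (fun n : ℕ => W (n + 1)) L
      (by simpa using hL0.symm) (fun n => by
        obtain ⟨X, f, g, hX, hses, h2, -⟩ := hq (n + 1) (by omega)
        push_cast
        exact ⟨X, f, g, hX, hses, h2, fun B hB => hses.exists_extend (hWJ n B hB 0)⟩) hL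
    exact (gorenstein_iff _ _).2 ⟨V, by simpa using hV0, fun n =>
      (lt_or_ge n 0).elim (hVq n) (hVp n)⟩

end IsSemidualizing

/-! ### Biduality and the noetherian case -/

section

variable {C H K N : Type u} [AddCommGroup C] [Module R C] [AddCommGroup H] [Module R H]
  [AddCommGroup K] [Module R K] [AddCommGroup N] [Module R N]

variable (R C H) in
/-- The biduality map `H → Hom(Hom(H, C), C)`. -/
abbrev bidual : H →ₗ[R] (H →ₗ[R] C) →ₗ[R] C := LinearMap.applyₗ

theorem bidual_naturality (g : H →ₗ[R] K) (h : H) :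
    bidual R C K (g h) = bidual R C H h ∘ₗ LinearMap.lcomp R C g := rfl

theorem bidual_bijective_hom (h : Function.Bijective (bidual R C K)) :
    Function.Bijective (bidual R C (K →ₗ[R] C)) := by
  have h1 : LinearMap.lcomp R C (bidual R C K) ∘ bidual R C (K →ₗ[R] C) = id := by
    ext φ k; rfl
  refine (Function.Bijective.of_comp_iff' (f := LinearMap.lcomp R C (bidual R C K))
    (((LinearEquiv.ofBijective _ h).symm.congrLeft C R).bijective) _).1 ?_
  rw [h1]
  exact Function.bijective_id

theorem bidual_bijective_congr (e : H ≃ₗ[R] K) (h : Function.Bijective (bidual R C H)) :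
    Function.Bijective (bidual R C K) := by
  let e' : ((H →ₗ[R] C) →ₗ[R] C) ≃ₗ[R] ((K →ₗ[R] C) →ₗ[R] C) := (e.congrLeft C R).congrLeft C R
  have h1 : bidual R C K ∘ e = e' ∘ bidual R C H := by
    ext x φ
    rfl
  rw [← Function.Bijective.of_comp_iff _ e.bijective, h1]
  exact e'.bijective.comp h

theorem finite_hom [IsNoetherianRing R] [Module.Finite R H] [Module.Finite R K] :
    Module.Finite R (H →ₗ[R] K) := by
  obtain ⟨n, g, hg⟩ := Module.Finite.exists_fin' R H
  exact Module.Finite.of_injective (LinearMap.lcomp R K g) (lcomp_injective_of_surjective hg)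

theorem bidual_bijective_of_projective (hC : Function.Bijective (LinearMap.lsmul R C))
    [Module.Finite R H] [Module.Projective R H] : Function.Bijective (bidual R C H) := by
  obtain ⟨n, b, c, hb⟩ := exists_dual_basis (R := R) H
  constructor
  · rw [injective_iff_map_eq_zero]
    intro x hx
    rw [← hb x]
    refine Finset.sum_eq_zero fun i _ => ?_
    have h1 : c i x = 0 := by
      apply hC.1
      rw [map_zero]
      ext y
      exact LinearMap.congr_fun hx ((c i).smulRight y)
    rw [h1, zero_smul]
  · intro ξ
    choose r hr using fun i => hC.2 (ξ ∘ₗ LinearMap.smulRightₗ (c i))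
    refine ⟨∑ i, r i • b i, ?_⟩
    ext φ
    have h1 : φ = ∑ i, (c i).smulRight (φ (b i)) := by
      ext x
      conv_lhs => rw [← hb x]
      simp
    conv_rhs => rw [h1, map_sum]
    change φ (∑ i, r i • b i) = _
    rw [map_sum]
    refine Finset.sum_congr rfl fun i _ => ?_
    rw [map_smul]
    exact LinearMap.congr_fun (hr i) (φ (b i))

end

namespace IsSemidualizing

variable {C : ModuleCat.{u} R} (hC : IsSemidualizing C)
include hC

theorem finite : Module.Finite R C := by
  have := hC.finitePresentation
  infer_instance

/-- P ≅ Hom(C, P ⊗ C) is finite, so P ⊗ C ≅ Hom(P*, C) with Q = P*. Thus Hom(-, C) exchanges finite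
projectives and finite C-projectives. -/
theorem exists_equiv_hom [IsNoetherianRing R] {X : ModuleCat.{u} R} (hX : fg (cProjective C) X) :
    ∃ Q : ModuleCat.{u} R, Module.Finite R Q ∧ Module.Projective R Q ∧
      Nonempty (X ≃ₗ[R] (Q →ₗ[R] C)) := by
  obtain ⟨⟨P, hP, ⟨e⟩⟩, hfin⟩ := hX
  have := hC.finite
  have hP' : Module.Finite R P := by
    have := finite_hom (R := R) (H := C) (K := X)
    exact Module.Finite.equiv ((LinearEquiv.ofBijective _
      (hC.tensorUnit_bijective_of_flat (P := P))) ≪≫ₗ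
      (TensorProduct.comm R C P ≪≫ₗ e.toLinearEquiv.symm).congrRight).symm
  refine ⟨ModuleCat.of R (Module.Dual R P), inferInstanceAs (Module.Finite R (Module.Dual R P)),
    inferInstanceAs (Module.Projective R (Module.Dual R P)), ⟨e.toLinearEquiv ≪≫ₗ
    LinearEquiv.rTensor C (Module.evalEquiv R P) ≪≫ₗ dualTensorHomEquiv R (Module.Dual R P) C⟩⟩

theorem fg_cProjective_hom [IsNoetherianRing R] (Q : Type u) [AddCommGroup Q] [Module R Q]
    [Module.Finite R Q] [Module.Projective R Q] :
    fg (cProjective C) (ModuleCat.of R (Q →ₗ[R] C)) := by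
  have := hC.finite
  exact ⟨⟨ModuleCat.of R (Module.Dual R Q), inferInstanceAs (Module.Projective R (Module.Dual R Q)),
    ⟨(dualTensorHomEquiv R Q C).symm.toModuleIso⟩⟩, finite_hom⟩

theorem fg_cProjective_self : fg (cProjective C) C := ⟨cProjective_self, hC.finite⟩

theorem bidual_bijective_of_fg_cProjective [IsNoetherianRing R] {X : ModuleCat.{u} R}
    (hX : fg (cProjective C) X) : Function.Bijective (bidual R C X) := by
  obtain ⟨Q, _, _, ⟨e⟩⟩ := hC.exists_equiv_hom hX
  exact bidual_bijective_congr e.symm (bidual_bijective_hom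
    (bidual_bijective_of_projective hC.homothety_bijective))

theorem projective_dual_of_fg_cProjective [IsNoetherianRing R] {X : ModuleCat.{u} R}
    (hX : fg (cProjective C) X) : Module.Projective R (X →ₗ[R] C) := by
  obtain ⟨Q, _, _, ⟨e⟩⟩ := hC.exists_equiv_hom hX
  exact Module.Projective.of_equiv' ((LinearEquiv.ofBijective _
    (bidual_bijective_of_projective hC.homothety_bijective)) ≪≫ₗ e.symm.congrLeft C R)

theorem extZero_of_fg_cProjective [IsNoetherianRing R] {X N : ModuleCat.{u} R}
    (hX : fg (cProjective C) X) {k : ℕ} (hN : ExtZero R (k + 1) N C) :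
    ExtZero R (k + 1) N X := by
  obtain ⟨Q, _, _, ⟨e⟩⟩ := hC.exists_equiv_hom hX
  exact (hN.hom_right (Q := Q)).congr_right e.symm

theorem totallyReflexive_of_steps [IsNoetherianRing R] {W : ℤ → ModuleCat.{u} R}
    (hW : ∀ n, Step (fg (cProjective C)) (fg (cProjective C)) (fg (cProjective C))
      (W (n + 1)) (W n)) (n : ℤ) : IsTotallyReflexive C (W n) := by
  have hext : ∀ k, ExtZero R (k + 1) (W n) C := fun k =>
    ext_zero_of_steps_right (n₀ := n) (fun n _ => hW n) hC.fg_cProjective_self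
      (fun X hX k => hC.extZero_cProjective hX.1 cProjective_self k) k n le_rfl
  choose X f g hX hses hlift hextend using hW
  have hbidX := fun n => hC.bidual_bijective_of_fg_cProjective (hX n)
  have hproj := fun n => hC.projective_dual_of_fg_cProjective (hX n)
  have hses' := fun n => (hses n).hom_of_extend (hextend n C hC.fg_cProjective_self)
  have hinj : ∀ n, Function.Injective (bidual R C (W (n + 1))) := fun n => by
    rw [injective_iff_map_eq_zero]
    intro w hw
    apply (hses n).inj
    apply (hbidX n).1
    rw [bidual_naturality, hw, map_zero, map_zero, LinearMap.zero_comp]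
  have hsurj : ∀ n, Function.Surjective (bidual R C (W (n + 1 + 1))) := fun n ξ => by
    obtain ⟨x, hx⟩ := (hbidX (n + 1)).2 (ξ ∘ₗ LinearMap.lcomp R C (f (n + 1)))
    have h1 : g (n + 1) x = 0 := by
      apply hinj n
      rw [bidual_naturality, hx, map_zero]
      ext φ
      exact (congrArg ξ ((hses' (n + 1)).exact.apply_apply_eq_zero φ)).trans (map_zero ξ)
    obtain ⟨w, rfl⟩ := ((hses (n + 1)).exact x).1 h1
    refine ⟨w, ?_⟩
    ext φ
    obtain ⟨ψ, rfl⟩ := (hses' (n + 1)).surj φ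
    exact LinearMap.congr_fun hx ψ
  have hbij : ∀ n, Function.Bijective (bidual R C (W n)) := fun n => by
    obtain ⟨m, rfl⟩ : ∃ m, n = m + 1 + 1 := ⟨n - 1 - 1, by ring⟩
    exact ⟨hinj (m + 1), hsurj m⟩
  have hfin : Module.Finite R (W n) :=
    have := (hX n).2
    Module.Finite.of_surjective _ (hses n).surj
  refine ⟨hfin, (extVanish_iff _ _).2 hext, (extVanish_iff _ _).2 fun k => ?_, hbij n⟩
  have key : ∀ k n, ExtZero R (k + 1) (W (n + 1) →ₗ[R] C) C := by
    intro k
    induction k with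
    | zero =>
      intro n
      refine (hses' n).ext_one_right (extZero_of_projective 0) fun φ => ?_
      obtain ⟨w, rfl⟩ := (hbij n).2 φ
      obtain ⟨x, rfl⟩ := (hses n).surj w
      exact ⟨bidual R C (X n) x, rfl⟩
    | succ k ih =>
      intro n
      refine (hses' n).ext_right_of_mid ?_ (extZero_of_projective _)
      obtain ⟨m, rfl⟩ : ∃ m, n = m + 1 := ⟨n - 1, by ring⟩
      exact ih m
  obtain ⟨m, rfl⟩ : ∃ m, n = m + 1 := ⟨n - 1, by ring⟩
  exact key k m

/-- Cover Hom(N, C) by Rⁿ with kernel K and apply Hom(-, C): since N is its own bidual, this embeds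
N in Hom(Rⁿ, C) with cokernel L = Hom(K, C). -/
theorem totallyReflexive_step [IsNoetherianRing R] {N : ModuleCat.{u} R}
    (hN : IsTotallyReflexive C N) (hCN : ∀ k, ExtZero R (k + 1) C N) :
    ∃ L : ModuleCat.{u} R, (IsTotallyReflexive C L ∧ ∀ k, ExtZero R (k + 1) C L) ∧
      Step (fg (cProjective C)) (fg (cProjective C)) (fg (cProjective C)) N L := by
  have := hN.finite
  have := hC.finite
  have := finite_hom (R := R) (H := N) (K := C)
  have hext := (extVanish_iff _ _).1 hN.ext_vanish
  have hext' : ∀ k, ExtZero R (k + 1) (N →ₗ[R] C) C := (extVanish_iff _ _).1 hN.ext_dual_vanish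
  obtain ⟨n, p, hp⟩ := Module.Finite.exists_fin' R (N →ₗ[R] C)
  have hses := isSES_subtype_ker p hp
  have hses' := hses.hom_of_extend (hses.exists_extend (hext' 0))
  have hbidF := bidual_bijective_of_projective (H := Fin n → R) hC.homothety_bijective
  have hbidN : Function.Bijective (bidual R C N) := hN.biduality_bijective
  have hbidK : Function.Bijective (bidual R C (LinearMap.ker p)) := by
    constructor
    · refine (injective_iff_map_eq_zero (bidual R C (LinearMap.ker p))).2 fun x hx => ?_
      apply hses.inj
      apply hbidF.1
      rw [bidual_naturality, hx, map_zero, map_zero, LinearMap.zero_comp]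
    · intro ξ
      obtain ⟨x, hx⟩ := hbidF.2 (ξ ∘ₗ LinearMap.lcomp R C (LinearMap.ker p).subtype)
      have h1 : p x = 0 := by
        apply (bidual_bijective_hom hbidN).1
        rw [bidual_naturality, hx, map_zero]
        ext φ
        exact (congrArg ξ (hses'.exact.apply_apply_eq_zero φ)).trans (map_zero ξ)
      refine ⟨⟨x, h1⟩, ?_⟩
      ext φ
      obtain ⟨ψ, rfl⟩ := hses'.surj φ
      exact LinearMap.congr_fun hx ψ
  have hses₁ := hses'.comp_equiv (LinearEquiv.ofBijective _ hbidN) (LinearEquiv.refl R _)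
  have hFC := hC.fg_cProjective_hom (Fin n → R)
  have hLC : ∀ k, ExtZero R (k + 1) (LinearMap.ker p →ₗ[R] C) C := by
    rintro (_ | k)
    · refine hses₁.ext_one_right (hC.extZero_cProjective hFC.1 cProjective_self 0) fun φ => ?_
      -- φ : N → C equals p x for some x in Rⁿ, and evaluation at x extends it to Hom(Rⁿ, C).
      obtain ⟨x, rfl⟩ := hp φ
      exact ⟨bidual R C _ x, rfl⟩
    · exact hses₁.ext_right_of_mid (hext k) (hC.extZero_cProjective hFC.1 cProjective_self _)
  refine ⟨ModuleCat.of R (LinearMap.ker p →ₗ[R] C), ⟨⟨?_, (extVanish_iff _ _).2 hLC,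
    (extVanish_iff _ _).2 fun k => ?_, bidual_bijective_hom hbidK⟩, fun k => ?_⟩, ?_⟩
  · exact finite_hom
  · exact (hses.ext_left_of_mid (extZero_of_projective k) (hext' (k + 1))).congr_left
      (LinearEquiv.ofBijective _ hbidK)
  · exact hses₁.ext_to_right_of_mid (hC.extZero_cProjective cProjective_self hFC.1 k)
      (hCN (k + 1))
  · refine hses₁.step (X := ModuleCat.of R ((Fin n → R) →ₗ[R] C))
      (M := ModuleCat.of R (LinearMap.ker p →ₗ[R] C)) hFC ?_
      (fun Q hQ => hC.extZero_of_fg_cProjective hQ (hLC 0))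
    rintro A ⟨⟨P, hP, ⟨e⟩⟩, -⟩
    exact ((hCN 0).tensor_left (P := P)).congr_left e.toLinearEquiv.symm

theorem gorenstein_fg_cProjective [IsNoetherianRing R] :
    gorenstein (fg (cProjective C)) = totallyReflexive C ⊓ bassClass C := by
  ext M
  constructor
  · intro hM
    obtain ⟨W, rfl, hW⟩ := (gorenstein_iff _ _).1 hM
    exact ⟨hC.totallyReflexive_of_steps hW 0,
      hC.bassClass_of_steps hW (fun _ h => h.1) hC.fg_cProjective_self 0⟩
  · rintro ⟨hM, hB⟩
    have hM : IsTotallyReflexive C M := hM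
    have hB : InBassClass C M := hB
    have := hM.finite
    have := hC.finite
    let S : ModuleCat.{u} R → Prop := fun N => ∃ A : ModuleCat.{u} R, InAuslanderClass C A ∧
      Module.Finite R A ∧ Nonempty (C ⊗[R] A ≃ₗ[R] N) ∧
      ∀ Q, fg (cProjective C) Q → ∀ k, ExtZero R (k + 1) N Q
    have hS : S M := ⟨_, hB.hom, finite_hom,
      ⟨LinearEquiv.ofBijective _ hB.evaluation_bijective⟩, fun Q hQ k =>
        hC.extZero_of_fg_cProjective hQ ((extVanish_iff _ _).1 hM.ext_vanish k)⟩
    obtain ⟨L, hL0, hL⟩ := exists_seq_of_forall S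
      (fun N K => Step (fg (cProjective C)) (fg (cProjective C)) (fg (cProjective C)) K N)
      (fun N hN => by
        obtain ⟨A, hA, hfin, ⟨e⟩, hQ⟩ := hN
        obtain ⟨n, g, hg⟩ := Module.Finite.exists_fin' R A
        have hF : Module.Projective R (ModuleCat.of R (Fin n → R)) :=
          inferInstanceAs (Module.Projective R (Fin n → R))
        obtain ⟨h1, h2, h3⟩ := hC.auslanderClass_step hA e hF g hg
          (𝒳 := fg (cProjective C)) ⟨cProjective_tensor _ hF,
            inferInstanceAs (Module.Finite R (C ⊗[R] (Fin n → R)))⟩ (fun _ h => h.1) hQ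
        exact ⟨_, ⟨_, h1, inferInstanceAs (Module.Finite R (LinearMap.ker g)),
          ⟨LinearEquiv.refl R _⟩, h2⟩, h3.mono (fun _ h => h) (fun _ h => h.1) (fun _ h => h)⟩)
      M hS
    obtain ⟨K, hK0, hK⟩ := exists_seq_of_forall
      (fun N => IsTotallyReflexive C N ∧ ∀ k, ExtZero R (k + 1) C N)
      (fun N L => Step (fg (cProjective C)) (fg (cProjective C)) (fg (cProjective C)) N L)
      (fun N hN => hC.totallyReflexive_step hN.1 hN.2) M
      ⟨hM, (extVanish_iff _ _).1 hB.ext_vanish⟩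
    obtain ⟨V, hV0, hVp, hVq⟩ := exists_int_seq L K (hL0.trans hK0.symm) hL hK
    exact (gorenstein_iff _ _).2 ⟨V, hV0.trans hL0, fun n =>
      (lt_or_ge n 0).elim (hVq n) (hVp n)⟩

end IsSemidualizing

end GorensteinCat

end

theorem mainTheorem6 {R : Type u} [CommRing R] (C : ModuleCat.{u} R)
    (hC : GorensteinCat.IsSemidualizing C) :
    GorensteinCat.gorenstein (GorensteinCat.cProjective C) =
        GorensteinCat.gcProjective C ⊓ GorensteinCat.bassClass C ∧
      GorensteinCat.gorenstein (GorensteinCat.cInjective C) =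
        GorensteinCat.gcInjective C ⊓ GorensteinCat.auslanderClass C ∧
      (IsNoetherianRing R →
        GorensteinCat.gorenstein (GorensteinCat.fg (GorensteinCat.cProjective C)) =
          GorensteinCat.totallyReflexive C ⊓ GorensteinCat.bassClass C) :=
  ⟨hC.gorenstein_cProjective, hC.gorenstein_cInjective, fun _ => hC.gorenstein_fg_cProjective⟩
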